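/- Let $\mathsf{CRING}^{op}$ be the opposite of the category of commutative rings, with its Cartesian tangent structure $\mathbb{T}=(\mathsf{T},\mathsf{p},+,0,\ell,\mathsf{c})$ in which, written in $\mathsf{CRING}$, $\mathsf{T}(R)=\mathrm{Sym}_R(\Omega_{R/\mathbb{Z}})$ is generated over $R$ by symbols $\mathsf{d}(a)$ ($a\in R$) with $\mathsf{d}(a+b)=\mathsf{d}(a)+\mathsf{d}(b)$, $\mathsf{d}(ab)=a\,\mathsf{d}(b)+b\,\mathsf{d}(a)$, and the structure maps are the ring morphisms $\mathsf{p}:R\to\mathsf{T}(R)$, $a\mapsto a$; $0:\mathsf{T}(R)\to R$, $a\mapsto a$, $\mathsf{d}(a)\mapsto 0$; $+:\mathsf{T}(R)\to\mathsf{T}(R)\otimes_R\mathsf{T}(R)$, $\mathsf{d}(a)\mapsto \mathsf{d}(a)\otimes1+1\otimes\mathsf{d}(a)$; $\ell:\mathsf{T}^2(R)\to\mathsf{T}(R)$, $a\mapsto a$, $\mathsf{d}(a),\mathsf{d}'(a)\mapsto 0$, $\mathsf{d}'\mathsf{d}(a)\mapsto\mathsf{d}(a)$; $\mathsf{c}:\mathsf{T}^2(R)\to\mathsf{T}^2(R)$,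 exchanging $\mathsf{d}(a)$ and $\mathsf{d}'(a)$ and fixing $a$ and $\mathsf{d}'\mathsf{d}(a)$. A differential object of $(\mathsf{CRING}^{op},\mathbb{T})$ is a differential bundle $\mathcal{E}=(\mathsf{q}:E\to *,\sigma,\mathsf{z},\lambda)$ (in the sense of Cockett and Cruttwell) over the terminal object $*=\mathbb{Z}$ of $\mathsf{CRING}^{op}$; a morphism of differential objects is a map of total objects in $\mathsf{CRING}^{op}$ commuting with the projections and with the lifts. Let $\mathsf{DIFF}[(\mathsf{CRING}^{op},\mathbb{T})]$ be the resulting category. For a differential object $\mathcal{E}$, with lift viewed as a ring morphism $\lambda:\mathsf{T}(E)\to E$, let $\mathsf{D}_\lambda:E\to E$, $\mathsf{D}_\lambda(x)=\lambda(\mathsf{d}(x))$. (1) The assignment $\mathcal{E}\mapsto\mathrm{im}(\mathsf{D}_\lambda)$ induces a bijection between isomorphism classes of differential objects in $(\mathsf{CRING}^{op},\mathbb{T})$ and isomorphism classes of abelian groups (that is, of $\mathbb{Z}$-modules). The class of an abelian group $G$ is the image of the class of a differential object with total ring $\mathrm{Sym}_{\mathbb{Z}}(G)$ whose structure maps, written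 in $\mathsf{CRING}$, satisfy, for $g\in G$, $\mathsf{z}(g)=0$, $\sigma(g)=g\otimes1+1\otimes g$, $\lambda(g)=0$ and $\lambda(\mathsf{d}(g))=g$. (2) There are equivalences of categories $$\mathsf{DIFF}[(\mathsf{CRING}^{op},\mathbb{T})]\simeq\mathsf{MOD}_{\mathbb{Z}}^{op}\simeq\mathsf{Ab}^{op},$$ where $\mathsf{MOD}_{\mathbb Z}$ and $\mathsf{Ab}$ are the categories of $\mathbb{Z}$-modules and of abelian groups. Moreover, the functor $\mathsf{DIFF}[(\mathsf{CRING}^{op},\mathbb{T})]\to\mathsf{Ab}^{op}$ that sends $\mathcal{E}$ to $\mathrm{im}(\mathsf{D}_\lambda)$ and a morphism to the restriction of its underlying ring morphism is an equivalence. -/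

import Mathlib

open CategoryTheory CategoryTheory.Limits Opposite
open scoped KaehlerDifferential

universe v u

/-! ### Fibre powers of a map -/

section FibrePowers

variable {C : Type u} [Category.{v} C]

/-- The diagram whose limit is the pullback of `n` copies of `q : E ⟶ A`. -/
abbrev fibreDiagram {E A : C} (q : E ⟶ A) (n : ℕ) : WidePullbackShape (Fin n) ⥤ C :=
  WidePullbackShape.wideCospan A (fun _ : Fin n => E) (fun _ => q)

/-- For every `n`, the pullback of `n` copies of `q` exists. -/
class HasFibrePowers {E A : C} (q : E ⟶ A) : Prop where
  hasLimit : ∀ n : ℕ, HasLimit (fibreDiagram q n)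

attribute [instance] HasFibrePowers.hasLimit

/-- The pullback `E_n` of `n` copies of `q : E ⟶ A`. -/
noncomputable def fibrePow {E A : C} (q : E ⟶ A) [HasFibrePowers q] (n : ℕ) : C :=
  limit (fibreDiagram q n)

namespace fibrePow

variable {E A : C} (q : E ⟶ A) [HasFibrePowers q]

/-- The projections `E_n ⟶ E`. -/
noncomputable def π {n : ℕ} (i : Fin n) : fibrePow q n ⟶ E :=
  limit.π (fibreDiagram q n) (some i)

theorem π_proj {n : ℕ} (i j : Fin n) : π q i ≫ q = π q j ≫ q :=
  (limit.w (fibreDiagram q n) (WidePullbackShape.Hom.term i)).trans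
    (limit.w (fibreDiagram q n) (WidePullbackShape.Hom.term j)).symm

/-- The pairing `⟨f, g⟩ : X ⟶ E_2`. -/
noncomputable def pair {X : C} (f g : X ⟶ E) (h : f ≫ q = g ≫ q) : X ⟶ fibrePow q 2 :=
  limit.lift (fibreDiagram q 2)
    (WidePullbackShape.mkCone (F := fibreDiagram q 2) (f ≫ q) ![f, g]
      (Fin.forall_fin_two.2 ⟨rfl, h.symm⟩))

@[simp]
theorem pair_fst {X : C} (f g : X ⟶ E) (h : f ≫ q = g ≫ q) : pair q f g h ≫ π q 0 = f :=
  limit.lift_π _ _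

@[simp]
theorem pair_snd {X : C} (f g : X ⟶ E) (h : f ≫ q = g ≫ q) : pair q f g h ≫ π q 1 = g :=
  limit.lift_π _ _

theorem hom_ext {X : C} {f g : X ⟶ fibrePow q 2} (h0 : f ≫ π q 0 = g ≫ π q 0)
    (h1 : f ≫ π q 1 = g ≫ π q 1) : f = g := by
  have hb : ∀ k : X ⟶ fibrePow q 2,
      k ≫ limit.π (fibreDiagram q 2) none = (k ≫ π q 0) ≫ q := fun k =>
    (congrArg (k ≫ ·) (limit.w (fibreDiagram q 2) (WidePullbackShape.Hom.term 0)).symm).trans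
      (Category.assoc _ _ _).symm
  refine limit.hom_ext (F := fibreDiagram q 2) ?_
  rintro (_ | i)
  · exact (hb f).trans ((congrArg (· ≫ q) h0).trans (hb g).symm)
  · revert i
    exact Fin.forall_fin_two.2 ⟨h0, h1⟩

end fibrePow

/-- The iterates `T^m` of an endofunctor. -/
def iterFunctor (T : C ⥤ C) : ℕ → C ⥤ C
  | 0 => 𝟭 C
  | m + 1 => iterFunctor T m ⋙ T

/-- All iterates `T^m` preserve the pullbacks of `n` copies of `q`, for all `n`. -/
class IteratesPreserveFibrePowers (T : C ⥤ C) {E A : C} (q : E ⟶ A) : Prop where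
  preserves : ∀ m n : ℕ, PreservesLimit (fibreDiagram q n) (iterFunctor T m)

theorem IteratesPreserveFibrePowers.preserves_one (T : C ⥤ C) {E A : C} (q : E ⟶ A)
    [h : IteratesPreserveFibrePowers T q] (n : ℕ) : PreservesLimit (fibreDiagram q n) T :=
  h.preserves 1 n

namespace fibrePow

variable {E A : C} (T : C ⥤ C) (q : E ⟶ A) [HasFibrePowers q] [IteratesPreserveFibrePowers T q]

/-- `T(E_2)` is a pullback of two copies of `T(q)`. -/
noncomputable def isLimitMap (n : ℕ) :
    IsLimit (T.mapCone (limit.cone (fibreDiagram q n))) :=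
  haveI := IteratesPreserveFibrePowers.preserves_one T q n
  isLimitOfPreserves T (limit.isLimit (fibreDiagram q n))

/-- The pairing `⟨f, g⟩ : X ⟶ T(E_2)`, where `T(E_2)` is regarded as the pullback of two copies
of `T(q)`. -/
noncomputable def mapPair {X : C} (f g : X ⟶ T.obj E) (h : f ≫ T.map q = g ≫ T.map q) :
    X ⟶ T.obj (fibrePow q 2) :=
  (isLimitMap T q 2).lift
    (WidePullbackShape.mkCone (F := fibreDiagram q 2 ⋙ T) (f ≫ T.map q)
      ![f, g] (Fin.forall_fin_two.2 ⟨rfl, h.symm⟩))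

@[simp]
theorem mapPair_fst {X : C} (f g : X ⟶ T.obj E) (h : f ≫ T.map q = g ≫ T.map q) :
    mapPair T q f g h ≫ T.map (π q 0) = f :=
  (isLimitMap T q 2).fac _ (some 0)

@[simp]
theorem mapPair_snd {X : C} (f g : X ⟶ T.obj E) (h : f ≫ T.map q = g ≫ T.map q) :
    mapPair T q f g h ≫ T.map (π q 1) = g :=
  (isLimitMap T q 2).fac _ (some 1)

theorem map_hom_ext {X : C} {f g : X ⟶ T.obj (fibrePow q 2)}
    (h0 : f ≫ T.map (π q 0) = g ≫ T.map (π q 0))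
    (h1 : f ≫ T.map (π q 1) = g ≫ T.map (π q 1)) : f = g := by
  have hb : ∀ k : X ⟶ T.obj (fibrePow q 2),
      k ≫ T.map (limit.π (fibreDiagram q 2) none) = (k ≫ T.map (π q 0)) ≫ T.map q := fun k =>
    (congrArg (fun e => k ≫ T.map e)
      (limit.w (fibreDiagram q 2) (WidePullbackShape.Hom.term 0)).symm).trans
      ((congrArg (k ≫ ·) (T.map_comp _ _)).trans (Category.assoc _ _ _).symm)
  refine (isLimitMap T q 2).hom_ext ?_
  rintro (_ | i)
  · exact (hb f).trans ((congrArg (· ≫ T.map q) h0).trans (hb g).symm)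
  · revert i
    exact Fin.forall_fin_two.2 ⟨h0, h1⟩

end fibrePow

end FibrePowers

/-! ### Additive bundles and tangent structures -/

section Tangent

open fibrePow

variable {C : Type u} [Category.{v} C]

/-- An additive bundle structure on `q : E ⟶ A`: a commutative monoid structure on `q` in the slice
category over `A`. -/
structure AdditiveBundle {E A : C} (q : E ⟶ A) [HasFibrePowers q] where
  /-- the sum -/
  add : fibrePow q 2 ⟶ E
  /-- the zero -/
  zero : A ⟶ E
  add_proj : ∀ j : Fin 2, add ≫ q = π q j ≫ q
  zero_proj : zero ≫ q = 𝟙 A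
  add_assoc :
    pair q (pair q (π q (0 : Fin 3)) (π q 1) (π_proj q 0 1) ≫ add) (π q 2)
        (by rw [Category.assoc, add_proj 1, ← Category.assoc, pair_snd, π_proj q 1 2]) ≫ add =
      pair q (π q (0 : Fin 3)) (pair q (π q 1) (π q 2) (π_proj q 1 2) ≫ add)
        (by rw [Category.assoc, add_proj 0, ← Category.assoc, pair_fst, π_proj q 0 1]) ≫ add
  zero_add : pair q (q ≫ zero) (𝟙 E) (by simp [zero_proj]) ≫ add = 𝟙 E
  add_zero : pair q (𝟙 E) (q ≫ zero) (by simp [zero_proj]) ≫ add = 𝟙 E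
  add_comm : pair q (π q 1) (π q 0) (π_proj q 1 0) ≫ add = add

/-- A tangent structure `(T, p, +, 0, ℓ, c)` on a category. -/
structure TangentStructure (C : Type u) [Category.{v} C] where
  /-- the tangent bundle functor -/
  T : C ⥤ C
  /-- the projection -/
  p : ∀ A : C, T.obj A ⟶ A
  p_natural : ∀ {A B : C} (f : A ⟶ B), T.map f ≫ p B = p A ≫ f
  [hasFibrePowers : ∀ A : C, HasFibrePowers (p A)]
  [preserves : ∀ A : C, IteratesPreserveFibrePowers T (p A)]
  /-- the sum and the zero; they make the projection an additive bundle -/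
  bundle : ∀ A : C, AdditiveBundle (p A)
  add_natural : ∀ {A B : C} (f : A ⟶ B),
    pair (p B) (π (p A) 0 ≫ T.map f) (π (p A) 1 ≫ T.map f)
        (by simp only [Category.assoc, p_natural]
            rw [← Category.assoc, π_proj (p A) 0 1, Category.assoc]) ≫ (bundle B).add =
      (bundle A).add ≫ T.map f
  zero_natural : ∀ {A B : C} (f : A ⟶ B), f ≫ (bundle B).zero = (bundle A).zero ≫ T.map f
  /-- the vertical lift -/
  ℓ : ∀ A : C, T.obj A ⟶ T.obj (T.obj A)
  ℓ_natural : ∀ {A B : C} (f : A ⟶ B), T.map f ≫ ℓ B = ℓ A ≫ T.map (T.map f)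
  /-- the canonical flip -/
  c : ∀ A : C, T.obj (T.obj A) ⟶ T.obj (T.obj A)
  c_natural : ∀ {A B : C} (f : A ⟶ B), T.map (T.map f) ≫ c B = c A ≫ T.map (T.map f)
  -- the vertical lift preserves the additive bundle structure
  ℓ_proj : ∀ A : C, ℓ A ≫ T.map (p A) = p A ≫ (bundle A).zero
  ℓ_add : ∀ A : C,
    mapPair T (p A) (π (p A) 0 ≫ ℓ A) (π (p A) 1 ≫ ℓ A)
        (by simp only [Category.assoc, ℓ_proj]
            rw [← Category.assoc, π_proj (p A) 0 1, Category.assoc]) ≫ T.map (bundle A).add =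
      (bundle A).add ≫ ℓ A
  ℓ_zero : ∀ A : C, (bundle A).zero ≫ ℓ A = (bundle A).zero ≫ T.map (bundle A).zero
  -- the canonical flip preserves the additive bundle structure
  c_proj : ∀ A : C, c A ≫ p (T.obj A) = T.map (p A)
  c_add : ∀ A : C,
    pair (p (T.obj A)) (T.map (π (p A) 0) ≫ c A) (T.map (π (p A) 1) ≫ c A)
        (by simp only [Category.assoc, c_proj, ← T.map_comp, π_proj (p A) 0 1]) ≫
        (bundle (T.obj A)).add =
      T.map (bundle A).add ≫ c A
  c_zero : ∀ A : C, T.map (bundle A).zero ≫ c A = (bundle (T.obj A)).zero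
  -- symmetry of the canonical flip
  c_c : ∀ A : C, c A ≫ c A = 𝟙 _
  yang_baxter : ∀ A : C, T.map (c A) ≫ c (T.obj A) ≫ T.map (c A) =
    c (T.obj A) ≫ T.map (c A) ≫ c (T.obj A)
  -- compatibility of the vertical lift and the canonical flip
  ℓ_ℓ : ∀ A : C, ℓ A ≫ ℓ (T.obj A) = ℓ A ≫ T.map (ℓ A)
  ℓ_c : ∀ A : C, ℓ A ≫ c A = ℓ A
  ℓ_c_c : ∀ A : C, ℓ (T.obj A) ≫ T.map (c A) ≫ c (T.obj A) = c A ≫ T.map (ℓ A)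
  -- universality of the vertical lift
  universal : ∀ (A : C) (n : ℕ),
    IsPullback
      ((iterFunctor T n).map
        (mapPair T (p A) (π (p A) 0 ≫ ℓ A) (π (p A) 1 ≫ (bundle (T.obj A)).zero)
          (by rw [Category.assoc, ℓ_proj, Category.assoc, ← zero_natural, ← Category.assoc,
                π_proj (p A) 0 1, Category.assoc]) ≫ T.map (bundle A).add))
      ((iterFunctor T n).map (π (p A) (0 : Fin 2) ≫ p A))
      ((iterFunctor T n).map (T.map (p A)))
      ((iterFunctor T n).map (bundle A).zero)

attribute [instance] TangentStructure.hasFibrePowers TangentStructure.preserves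

/-- A tangent structure is Cartesian if the category has finite products and the canonical maps
`T(A × B) ⟶ T(A) × T(B)` and `T(*) ⟶ *` are isomorphisms. -/
class TangentStructure.IsCartesian (𝕋 : TangentStructure C) : Prop where
  [hasFiniteProducts : HasFiniteProducts C]
  isIso_prod : ∀ A B : C, IsIso (prod.lift (𝕋.T.map (prod.fst : A ⨯ B ⟶ A))
    (𝕋.T.map (prod.snd : A ⨯ B ⟶ B)))
  isIso_terminal : IsIso (terminal.from (𝕋.T.obj (⊤_ C)))

/-! ### Differential bundles -/

/-- A differential bundle `(q : E ⟶ A, σ, z, λ)` over `A`. -/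
structure DifferentialBundle (𝕋 : TangentStructure C) (A : C) where
  /-- the total object -/
  E : C
  /-- the projection -/
  q : E ⟶ A
  [hasFibrePowers : HasFibrePowers q]
  [preserves : IteratesPreserveFibrePowers 𝕋.T q]
  /-- the sum `σ` and the zero `z`; they make the projection an additive bundle -/
  bundle : AdditiveBundle q
  /-- the lift `λ` -/
  lift : E ⟶ 𝕋.T.obj E
  -- the lift is additive with respect to the image under `T` of the additive structure of `q`
  lift_map_proj : lift ≫ 𝕋.T.map q = q ≫ (𝕋.bundle A).zero
  lift_map_add :
    mapPair 𝕋.T q (π q 0 ≫ lift) (π q 1 ≫ lift)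
        (by simp only [Category.assoc, lift_map_proj]
            rw [← Category.assoc, π_proj q 0 1, Category.assoc]) ≫ 𝕋.T.map bundle.add =
      bundle.add ≫ lift
  lift_map_zero : bundle.zero ≫ lift = (𝕋.bundle A).zero ≫ 𝕋.T.map bundle.zero
  -- the lift is additive with respect to the additive structure of the tangent bundle of `E`
  lift_proj : lift ≫ 𝕋.p E = q ≫ bundle.zero
  lift_add :
    pair (𝕋.p E) (π q 0 ≫ lift) (π q 1 ≫ lift)
        (by simp only [Category.assoc, lift_proj]
            rw [← Category.assoc, π_proj q 0 1, Category.assoc]) ≫ (𝕋.bundle E).add =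
      bundle.add ≫ lift
  lift_zero : bundle.zero ≫ lift = bundle.zero ≫ (𝕋.bundle E).zero
  -- compatibility with the vertical lift
  lift_lift : lift ≫ 𝕋.T.map lift = lift ≫ 𝕋.ℓ E
  -- universality of the lift
  universal : ∀ n : ℕ,
    IsPullback
      ((iterFunctor 𝕋.T n).map
        (mapPair 𝕋.T q (π q 0 ≫ lift) (π q 1 ≫ (𝕋.bundle E).zero)
          (by rw [Category.assoc, lift_map_proj, Category.assoc, ← 𝕋.zero_natural,
                ← Category.assoc, π_proj q 0 1, Category.assoc]) ≫ 𝕋.T.map bundle.add))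
      ((iterFunctor 𝕋.T n).map (π q (0 : Fin 2) ≫ q))
      ((iterFunctor 𝕋.T n).map (𝕋.T.map q))
      ((iterFunctor 𝕋.T n).map (𝕋.bundle A).zero)

attribute [instance] DifferentialBundle.hasFibrePowers DifferentialBundle.preserves

namespace DifferentialBundle

variable {𝕋 : TangentStructure C} {A : C}

/-- A differential bundle morphism over `A`: it commutes with the projections and the lifts. -/
@[ext]
structure Hom (𝓔 𝓔' : DifferentialBundle 𝕋 A) where
  /-- the underlying map of total objects -/
  hom : 𝓔.E ⟶ 𝓔'.E
  w_proj : hom ≫ 𝓔'.q = 𝓔.q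
  w_lift : hom ≫ 𝓔'.lift = 𝓔.lift ≫ 𝕋.T.map hom

/-- The category of differential bundles over `A` and differential bundle morphisms over `A`. -/
instance : Category (DifferentialBundle 𝕋 A) where
  Hom := Hom
  id 𝓔 := ⟨𝟙 _, by simp, by simp⟩
  comp f g := ⟨f.hom ≫ g.hom, by rw [Category.assoc, g.w_proj, f.w_proj], by
    rw [Category.assoc, g.w_lift, ← Category.assoc, f.w_lift, Category.assoc, 𝕋.T.map_comp]⟩
  id_comp f := Hom.ext (Category.id_comp f.hom)
  comp_id f := Hom.ext (Category.comp_id f.hom)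
  assoc f g h := Hom.ext (Category.assoc f.hom g.hom h.hom)

end DifferentialBundle

/-- The category of differential objects of a Cartesian tangent category: differential bundles over
a terminal object, with the differential bundle morphisms over it. -/
abbrev DiffObj (𝕋 : TangentStructure C) [𝕋.IsCartesian] {A : C} (_hA : IsTerminal A) :=
  DifferentialBundle 𝕋 A

end Tangent

/-! ### The tangent algebra of a commutative ring -/

/-- The tangent algebra `T(R) = Sym_R(Ω(R))` of a commutative ring, where `Ω(R)` is the module of
Kähler differentials of `R` over `ℤ`. -/
def TanRing (R : Type u) [CommRing R] : Type u := SymmetricAlgebra R Ω[R⁄ℤ]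

namespace TanRing

noncomputable instance (R : Type u) [CommRing R] : CommRing (TanRing R) :=
  inferInstanceAs (CommRing (SymmetricAlgebra R Ω[R⁄ℤ]))

variable {R : Type u} [CommRing R] {S : Type u} [CommRing S]

/-- The inclusion `R → T(R)`. -/
noncomputable def of : R →+* TanRing R := algebraMap R (SymmetricAlgebra R Ω[R⁄ℤ])

/-- The generators `d(a)` of `T(R)`. -/
noncomputable def d : R →+ TanRing R :=
  (SymmetricAlgebra.ι R Ω[R⁄ℤ]).toAddMonoidHom.comp
    (KaehlerDifferential.D ℤ R).toLinearMap.toAddMonoidHom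

theorem d_mul (a b : R) : d (a * b) = of a * d b + of b * d a := by
  change SymmetricAlgebra.ι R Ω[R⁄ℤ] (KaehlerDifferential.D ℤ R (a * b)) = _
  rw [Derivation.leibniz, map_add, map_smul, map_smul, Algebra.smul_def, Algebra.smul_def]
  rfl

/-- A ring morphism with domain `T(R)` is given by a ring morphism `f` on `R` and by the images
`D a` of the generators `d(a)`. -/
noncomputable def lift (f : R →+* S) (D : R →+ S)
    (h : ∀ a b, D (a * b) = f a * D b + f b * D a) : TanRing R →+* S :=
  letI := f.toAlgebra
  (SymmetricAlgebra.lift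
    (Derivation.mk' (R := ℤ) (A := R) (M := S) D.toIntLinearMap h).liftKaehlerDifferential).toRingHom

@[simp]
theorem lift_of (f : R →+* S) (D : R →+ S) (h) (a : R) : lift f D h (of a) = f a :=
  let _ := f.toAlgebra
  AlgHom.commutes (SymmetricAlgebra.lift
    (Derivation.mk' (R := ℤ) (A := R) (M := S) D.toIntLinearMap h).liftKaehlerDifferential) a

@[simp]
theorem lift_d (f : R →+* S) (D : R →+ S) (h) (a : R) : lift f D h (d a) = D a := by
  let _ := f.toAlgebra
  exact (SymmetricAlgebra.lift_ι_apply _ _).trans (Derivation.liftKaehlerDifferential_comp_D _ _)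

theorem hom_ext {f g : TanRing R →+* S} (h : ∀ a, f (of a) = g (of a))
    (h' : ∀ a, f (d a) = g (d a)) : f = g := by
  let _ : Algebra R S := (f.comp of).toAlgebra
  let F : SymmetricAlgebra R Ω[R⁄ℤ] →ₐ[R] S := ⟨f, fun a => rfl⟩
  let G : SymmetricAlgebra R Ω[R⁄ℤ] →ₐ[R] S := ⟨g, fun a => (h a).symm⟩
  have : F = G := by
    refine SymmetricAlgebra.algHom_ext ?_
    refine Derivation.liftKaehlerDifferential_unique _ _ ?_
    ext a
    exact h' a
  ext x
  exact congrArg (fun k : SymmetricAlgebra R Ω[R⁄ℤ] →ₐ[R] S => k x) this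

/-- The ring morphism `T(R) → T(S)` induced by `f`. -/
noncomputable def map (f : R →+* S) : TanRing R →+* TanRing S :=
  lift (of.comp f) (d.comp f.toAddMonoidHom) fun a b => by simp [d_mul]

@[simp] theorem map_of (f : R →+* S) (a : R) : map f (of a) = of (f a) := lift_of _ _ _ a
@[simp] theorem map_d (f : R →+* S) (a : R) : map f (d a) = d (f a) := lift_d _ _ _ a

/-- The zero `T(R) → R`. -/
noncomputable def zero : TanRing R →+* R := lift (RingHom.id R) 0 fun a b => by simp

@[simp] theorem zero_of (a : R) : zero (of a) = a := lift_of _ _ _ a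
@[simp] theorem zero_d (a : R) : zero (d a) = 0 := lift_d _ _ _ a

/-- A pair of maps `i, j : T(R) → W` that agree on `R` has a sum `T(R) → W`. -/
noncomputable def add {W : Type u} [CommRing W] (i j : TanRing R →+* W)
    (h : ∀ a, i (of a) = j (of a)) : TanRing R →+* W :=
  lift (i.comp of) ((i.toAddMonoidHom.comp d) + (j.toAddMonoidHom.comp d)) fun a b => by
    simp [d_mul, h]; ring

@[simp] theorem add_of {W : Type u} [CommRing W] (i j : TanRing R →+* W) (h) (a : R) :
    add i j h (of a) = i (of a) := lift_of _ _ _ a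
@[simp] theorem add_d {W : Type u} [CommRing W] (i j : TanRing R →+* W) (h) (a : R) :
    add i j h (d a) = i (d a) + j (d a) := lift_d _ _ _ a

/-- Ring morphisms `T(R) → S` correspond to ring morphisms from `R` to the dual numbers of `S`. -/
noncomputable def homEquiv : (TanRing R →+* S) ≃ (R →+* DualNumber S) where
  toFun g :=
    { toFun := fun a => TrivSqZeroExt.inl (g (of a)) + TrivSqZeroExt.inr (g (d a))
      map_one' := by
        have : d (1 : R) = 0 := by simpa using d_mul (1 : R) 1
        ext <;> simp [this]
      map_zero' := by ext <;> simp
      map_mul' := fun a b => by ext <;> simp [d_mul, mul_comm]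
      map_add' := fun a b => by ext <;> simp }
  invFun g := lift ((TrivSqZeroExt.fstHom ℤ S S).toRingHom.comp g)
    ((TrivSqZeroExt.sndHom S S).toAddMonoidHom.comp g.toAddMonoidHom) fun a b => by
      simp [mul_comm]
  left_inv g := hom_ext (fun a => by simp) (fun a => by simp)
  right_inv g := by ext a <;> simp

@[simp] theorem homEquiv_fst (g : TanRing R →+* S) (a : R) : (homEquiv g a).fst = g (of a) := by
  simp [homEquiv]
@[simp] theorem homEquiv_snd (g : TanRing R →+* S) (a : R) : (homEquiv g a).snd = g (d a) := by
  simp [homEquiv]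
@[simp] theorem homEquiv_symm_of (g : R →+* DualNumber S) (a : R) :
    homEquiv.symm g (of a) = (g a).fst := lift_of _ _ _ a
@[simp] theorem homEquiv_symm_d (g : R →+* DualNumber S) (a : R) :
    homEquiv.symm g (d a) = (g a).snd := lift_d _ _ _ a

/-- A ring morphism with domain `T(T(R))` is given by its values on the four kinds of generators
`a`, `d(a)`, `d'(a)` and `d'd(a)`. -/
noncomputable def lift₂ (f : R →+* S) (D D' D'' : R →+ S)
    (h : ∀ a b, D (a * b) = f a * D b + f b * D a)
    (h' : ∀ a b, D' (a * b) = f a * D' b + f b * D' a)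
    (h'' : ∀ a b, D'' (a * b) = f a * D'' b + D b * D' a + (f b * D'' a + D a * D' b)) :
    TanRing (TanRing R) →+* S :=
  homEquiv.symm (lift (homEquiv (lift f D' h'))
    { toFun := fun a => TrivSqZeroExt.inl (D a) + TrivSqZeroExt.inr (D'' a)
      map_zero' := by ext <;> simp
      map_add' := fun a b => by ext <;> simp } fun a b => by
        ext
        · simp [h]
        · simp [h'']; ring)

section lift₂

variable (f : R →+* S) (D D' D'' : R →+ S) (h h' h'') (a : R)

@[simp] theorem lift₂_of_of : lift₂ f D D' D'' h h' h'' (of (of a)) = f a := by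
  simp [lift₂]
@[simp] theorem lift₂_of_d : lift₂ f D D' D'' h h' h'' (of (d a)) = D a := by
  simp [lift₂]
@[simp] theorem lift₂_d_of : lift₂ f D D' D'' h h' h'' (d (of a)) = D' a := by
  simp [lift₂]
@[simp] theorem lift₂_d_d : lift₂ f D D' D'' h h' h'' (d (d a)) = D'' a := by
  simp [lift₂]

end lift₂

/-- The vertical lift `T(T(R)) → T(R)`. -/
noncomputable def ell : TanRing (TanRing R) →+* TanRing R :=
  lift₂ of 0 0 d (by simp) (by simp) (by simp [d_mul])

@[simp] theorem ell_of_of (a : R) : ell (of (of a)) = of a := lift₂_of_of ..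
@[simp] theorem ell_of_d (a : R) : ell (of (d a)) = 0 := lift₂_of_d ..
@[simp] theorem ell_d_of (a : R) : ell (d (of a)) = 0 := lift₂_d_of ..
@[simp] theorem ell_d_d (a : R) : ell (d (d a)) = d a := lift₂_d_d ..

/-- The canonical flip `T(T(R)) → T(T(R))`. -/
noncomputable def flip : TanRing (TanRing R) →+* TanRing (TanRing R) :=
  lift₂ (of.comp of) (d.comp (of (R := R)).toAddMonoidHom)
    ((of (R := TanRing R)).toAddMonoidHom.comp d) (d.comp d)
    (by simp [d_mul]) (by simp [d_mul]) (by intro a b; simp [d_mul]; ring)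

@[simp] theorem flip_of_of (a : R) : flip (of (of a)) = of (of a) := lift₂_of_of ..
@[simp] theorem flip_of_d (a : R) : flip (of (d a)) = d (of a) := lift₂_of_d ..
@[simp] theorem flip_d_of (a : R) : flip (d (of a)) = of (d a) := lift₂_d_of ..
@[simp] theorem flip_d_d (a : R) : flip (d (d a)) = d (d a) := lift₂_d_d ..

end TanRing

/-! ### The tangent structure on the opposite of the category of commutative rings -/

/-- The functor `T` on commutative rings. -/
noncomputable def tanFunctor : CommRingCat.{u} ⥤ CommRingCat.{u} where
  obj R := CommRingCat.of (TanRing R)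
  map f := CommRingCat.ofHom (TanRing.map f.hom)
  map_id R := by
    ext : 1
    exact TanRing.hom_ext (fun a => by simp) (fun a => by simp)
  map_comp f g := by
    ext : 1
    exact TanRing.hom_ext (fun a => by simp) (fun a => by simp)

/-- `T` is left adjoint to the dual numbers functor. -/
noncomputable def tanAdjunction := Adjunction.adjunctionOfEquivRight
  (F := tanFunctor.{u}) (G_obj := fun S => CommRingCat.of (DualNumber S))
  (fun R S => (ConcreteCategory.homEquiv (C := CommRingCat) (X := tanFunctor.obj R) (Y := S)).trans
    (TanRing.homEquiv.trans (ConcreteCategory.homEquiv (C := CommRingCat)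
      (X := R) (Y := CommRingCat.of (DualNumber S))).symm))
  (fun R' R S f g => by
    refine CommRingCat.hom_ext (RingHom.ext fun a => TrivSqZeroExt.ext ?_ ?_)
    · exact (TanRing.homEquiv_fst _ _).trans ((congrArg g.hom (TanRing.map_of f.hom a)).trans
        (TanRing.homEquiv_fst _ _).symm)
    · exact (TanRing.homEquiv_snd _ _).trans ((congrArg g.hom (TanRing.map_d f.hom a)).trans
        (TanRing.homEquiv_snd _ _).symm))

namespace CRingOp

open TanRing fibrePow

/-- The ring morphism underlying a map of `CRING^op`. -/
abbrev ev {X Y : CommRingCat.{u}ᵒᵖ} (f : X ⟶ Y) : Y.unop →+* X.unop := f.unop.hom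

/-- The map of `CRING^op` given by a ring morphism. -/
abbrev mk {X Y : CommRingCat.{u}ᵒᵖ} (f : Y.unop →+* X.unop) : X ⟶ Y := (CommRingCat.ofHom f).op

/-- The tangent bundle functor on `CRING^op`. -/
noncomputable def T : CommRingCat.{u}ᵒᵖ ⥤ CommRingCat.{u}ᵒᵖ := tanFunctor.op

instance : PreservesLimitsOfSize.{0, 0} T.{u} :=
  tanAdjunction.op.rightAdjoint_preservesLimits

instance (m : ℕ) : PreservesLimitsOfSize.{0, 0} (iterFunctor T.{u} m) := by
  induction m with
  | zero => exact inferInstanceAs (PreservesLimitsOfSize.{0, 0} (𝟭 _))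
  | succ m ih => exact inferInstanceAs (PreservesLimitsOfSize.{0, 0} (iterFunctor T.{u} m ⋙ T))

instance {E A : CommRingCat.{u}ᵒᵖ} (q : E ⟶ A) : HasFibrePowers q := ⟨fun _ => inferInstance⟩

instance {E A : CommRingCat.{u}ᵒᵖ} (q : E ⟶ A) : IteratesPreserveFibrePowers T q :=
  ⟨fun _ _ => inferInstance⟩

/-- The elements `a` of `T(R)`, for `a ∈ R`. -/
noncomputable def gen {A : CommRingCat.{u}ᵒᵖ} : A.unop →+* (T.obj A).unop := TanRing.of

/-- The elements `d(a)` of `T(R)`, for `a ∈ R`. -/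
noncomputable def dgen {A : CommRingCat.{u}ᵒᵖ} : A.unop →+ (T.obj A).unop := TanRing.d

theorem ev_comp {X Y Z : CommRingCat.{u}ᵒᵖ} (f : X ⟶ Y) (g : Y ⟶ Z) (a : Z.unop) :
    ev (f ≫ g) a = ev f (ev g a) := rfl

theorem ev_map_of {X Y : CommRingCat.{u}ᵒᵖ} (f : X ⟶ Y) (a : Y.unop) :
    ev (T.map f) (gen a) = (gen (ev f a)) := map_of _ _

theorem ev_map_d {X Y : CommRingCat.{u}ᵒᵖ} (f : X ⟶ Y) (a : Y.unop) :
    ev (T.map f) (dgen a) = (dgen (ev f a)) := map_d _ _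

theorem hom_ext {X A : CommRingCat.{u}ᵒᵖ} {f g : X ⟶ T.obj A}
    (h : ∀ a : A.unop, ev f (gen a) = ev g (gen a))
    (h' : ∀ a : A.unop, ev f (dgen a) = ev g (dgen a)) : f = g :=
  Quiver.Hom.unop_inj (CommRingCat.hom_ext (TanRing.hom_ext h h'))

section pairs

variable {E A X : CommRingCat.{u}ᵒᵖ} (q : E ⟶ A)

theorem ev_pair_fst (f g : X ⟶ E) (h) (a : E.unop) :
    ev (pair q f g h) (ev (π q 0) a) = ev f a :=
  congrArg (fun k : X ⟶ E => ev k a) (pair_fst q f g h)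

theorem ev_pair_snd (f g : X ⟶ E) (h) (a : E.unop) :
    ev (pair q f g h) (ev (π q 1) a) = ev g a :=
  congrArg (fun k : X ⟶ E => ev k a) (pair_snd q f g h)

theorem ev_mapPair_fst_of (f g : X ⟶ T.obj E) (h) (a : E.unop) :
    ev (mapPair T q f g h) (gen (ev (π q 0) a)) = ev f (gen a) :=
  (congrArg (ev (mapPair T q f g h)) (ev_map_of (π q 0) a)).symm.trans
    (congrArg (fun k : X ⟶ T.obj E => ev k (gen a)) (mapPair_fst T q f g h))

theorem ev_mapPair_snd_of (f g : X ⟶ T.obj E) (h) (a : E.unop) :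
    ev (mapPair T q f g h) (gen (ev (π q 1) a)) = ev g (gen a) :=
  (congrArg (ev (mapPair T q f g h)) (ev_map_of (π q 1) a)).symm.trans
    (congrArg (fun k : X ⟶ T.obj E => ev k (gen a)) (mapPair_snd T q f g h))

theorem ev_mapPair_fst_d (f g : X ⟶ T.obj E) (h) (a : E.unop) :
    ev (mapPair T q f g h) (dgen (ev (π q 0) a)) = ev f (dgen a) :=
  (congrArg (ev (mapPair T q f g h)) (ev_map_d (π q 0) a)).symm.trans
    (congrArg (fun k : X ⟶ T.obj E => ev k (dgen a)) (mapPair_fst T q f g h))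

theorem ev_mapPair_snd_d (f g : X ⟶ T.obj E) (h) (a : E.unop) :
    ev (mapPair T q f g h) (dgen (ev (π q 1) a)) = ev g (dgen a) :=
  (congrArg (ev (mapPair T q f g h)) (ev_map_d (π q 1) a)).symm.trans
    (congrArg (fun k : X ⟶ T.obj E => ev k (dgen a)) (mapPair_snd T q f g h))

end pairs

/-- The projection, given by the ring morphism `R → T(R)`, `a ↦ a`. -/
noncomputable def p (A : CommRingCat.{u}ᵒᵖ) : T.obj A ⟶ A :=
  mk (X := T.obj A) (TanRing.of (R := A.unop))

/-- The zero, given by the ring morphism `T(R) → R`, `a ↦ a`, `d(a) ↦ 0`. -/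
noncomputable def zero (A : CommRingCat.{u}ᵒᵖ) : A ⟶ T.obj A :=
  mk (Y := T.obj A) (TanRing.zero (R := A.unop))

/-- The vertical lift, given by the ring morphism `T(T(R)) → T(R)`,
`a ↦ a`, `d(a) ↦ 0`, `d'(a) ↦ 0`, `d'd(a) ↦ d(a)`. -/
noncomputable def ell (A : CommRingCat.{u}ᵒᵖ) : T.obj A ⟶ T.obj (T.obj A) :=
  mk (X := T.obj A) (Y := T.obj (T.obj A)) (TanRing.ell (R := A.unop))

/-- The canonical flip, given by the ring morphism `T(T(R)) → T(T(R))`,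
`a ↦ a`, `d(a) ↦ d'(a)`, `d'(a) ↦ d(a)`, `d'd(a) ↦ d'd(a)`. -/
noncomputable def flip (A : CommRingCat.{u}ᵒᵖ) : T.obj (T.obj A) ⟶ T.obj (T.obj A) :=
  mk (X := T.obj (T.obj A)) (Y := T.obj (T.obj A)) (TanRing.flip (R := A.unop))

theorem ev_π_of (A : CommRingCat.{u}ᵒᵖ) {n : ℕ} (i j : Fin n) (a : A.unop) :
    ev (π (p A) i) (gen a) = ev (π (p A) j) (gen a) :=
  congrArg (fun k : fibrePow (p A) n ⟶ A => ev k a) (π_proj (p A) i j)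

/-- The sum, given by the ring morphism `T(R) → T_2(R)`, `a ↦ π_1(a) = π_2(a)`,
`d(a) ↦ π_1(d(a)) + π_2(d(a))`, where `T_2(R)` is the pushout in commutative rings of two copies
of `R → T(R)`. -/
noncomputable def add (A : CommRingCat.{u}ᵒᵖ) : fibrePow (p A) 2 ⟶ T.obj A :=
  mk (Y := T.obj A) (TanRing.add (R := A.unop) (ev (π (p A) 0)) (ev (π (p A) 1))
    (ev_π_of A 0 1))

section

variable (A : CommRingCat.{u}ᵒᵖ) (a : A.unop)

theorem ev_p : ev (p A) a = (gen a) := rfl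
theorem ev_zero_of : ev (zero A) (gen a) = a := TanRing.zero_of a
theorem ev_zero_d : ev (zero A) (dgen a) = 0 := TanRing.zero_d a
theorem ev_add_of : ev (add A) (gen a) = ev (π (p A) 0) (gen a) :=
  TanRing.add_of _ _ (ev_π_of A 0 1) a
theorem ev_add_d : ev (add A) (dgen a) =
    ev (π (p A) 0) (dgen a) + ev (π (p A) 1) (dgen a) :=
  TanRing.add_d _ _ (ev_π_of A 0 1) a

end

/-- The additive bundle structure on the projection. -/
noncomputable def bundle (A : CommRingCat.{u}ᵒᵖ) : AdditiveBundle (p A) where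
  add := add A
  zero := zero A
  add_proj j := Quiver.Hom.unop_inj (CommRingCat.hom_ext (RingHom.ext fun a => by
    exact (ev_add_of A a).trans (ev_π_of A 0 j a)))
  zero_proj := Quiver.Hom.unop_inj (CommRingCat.hom_ext (RingHom.ext fun a => ev_zero_of A a))
  add_assoc := by
    refine hom_ext (fun a => ?_) (fun a => ?_)
    · simp only [ev_comp, ev_add_of, ev_pair_fst]
    · simp only [ev_comp, ev_add_d, map_add, ev_pair_fst, ev_pair_snd, add_assoc]
  zero_add := by
    refine hom_ext (fun a => ?_) (fun a => ?_)
    · simp only [ev_comp, ev_add_of, ev_pair_fst, ev_zero_of]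
      rfl
    · simp only [ev_comp, ev_add_d, map_add, ev_pair_fst, ev_pair_snd, ev_zero_d, map_zero]
      exact zero_add _
  add_zero := by
    refine hom_ext (fun a => ?_) (fun a => ?_)
    · simp only [ev_comp, ev_add_of, ev_pair_fst]
    · simp only [ev_comp, ev_add_d, map_add, ev_pair_fst, ev_pair_snd, ev_zero_d, map_zero]
      exact add_zero _
  add_comm := by
    refine hom_ext (fun a => ?_) (fun a => ?_)
    · simp only [ev_comp, ev_add_of, ev_pair_fst]
      exact ev_π_of A 1 0 a
    · simp only [ev_comp, ev_add_d, map_add, ev_pair_fst, ev_pair_snd]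
      exact add_comm _ _

theorem dgen_mul {A : CommRingCat.{u}ᵒᵖ} (a b : A.unop) :
    dgen (a * b) = gen a * dgen b + gen b * dgen a := TanRing.d_mul a b

section

variable (A : CommRingCat.{u}ᵒᵖ) (a : A.unop)

theorem ev_ell_gen_gen : ev (ell A) (gen (gen a)) = gen a := TanRing.ell_of_of a
theorem ev_ell_gen_dgen : ev (ell A) (gen (dgen a)) = 0 := TanRing.ell_of_d a
theorem ev_ell_dgen_gen : ev (ell A) (dgen (gen a)) = 0 := TanRing.ell_d_of a
theorem ev_ell_dgen_dgen : ev (ell A) (dgen (dgen a)) = dgen a := TanRing.ell_d_d a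

theorem ev_flip_gen_gen : ev (flip A) (gen (gen a)) = gen (gen a) := TanRing.flip_of_of a
theorem ev_flip_gen_dgen : ev (flip A) (gen (dgen a)) = dgen (gen a) := TanRing.flip_of_d a
theorem ev_flip_dgen_gen : ev (flip A) (dgen (gen a)) = gen (dgen a) := TanRing.flip_d_of a
theorem ev_flip_dgen_dgen : ev (flip A) (dgen (dgen a)) = dgen (dgen a) := TanRing.flip_d_d a

end

theorem hom_ext₁ {X A : CommRingCat.{u}ᵒᵖ} {f g : X ⟶ A} (h : ∀ a : A.unop, ev f a = ev g a) :
    f = g :=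
  Quiver.Hom.unop_inj (CommRingCat.hom_ext (RingHom.ext h))

/-- The map `X[ε] ⟶ A` of `CRING^op` corresponding to a map `X ⟶ T(A)`. -/
noncomputable def hat {X A : CommRingCat.{u}ᵒᵖ} (f : X ⟶ T.obj A) :
    op (CommRingCat.of (DualNumber X.unop)) ⟶ A :=
  mk (X := op (CommRingCat.of (DualNumber X.unop))) (TanRing.homEquiv (R := A.unop) (ev f))

theorem hat_inj {X A : CommRingCat.{u}ᵒᵖ} {f g : X ⟶ T.obj A} (h : hat f = hat g) : f = g :=
  Quiver.Hom.unop_inj (CommRingCat.hom_ext (TanRing.homEquiv.injective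
    (congrArg (fun k => ev k) h)))

theorem ev_hat_eq {X A : CommRingCat.{u}ᵒᵖ} {f g : X ⟶ T.obj A} {a : A.unop}
    (h : ev f (gen a) = ev g (gen a)) (h' : ev f (dgen a) = ev g (dgen a)) :
    ev (hat f) a = ev (hat g) a :=
  TrivSqZeroExt.ext ((TanRing.homEquiv_fst _ _).trans (h.trans (TanRing.homEquiv_fst _ _).symm))
    ((TanRing.homEquiv_snd _ _).trans (h'.trans (TanRing.homEquiv_snd _ _).symm))

theorem hom_ext₂ {X A : CommRingCat.{u}ᵒᵖ} {f g : X ⟶ T.obj (T.obj A)}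
    (h1 : ∀ a : A.unop, ev f (gen (gen a)) = ev g (gen (gen a)))
    (h2 : ∀ a : A.unop, ev f (gen (dgen a)) = ev g (gen (dgen a)))
    (h3 : ∀ a : A.unop, ev f (dgen (gen a)) = ev g (dgen (gen a)))
    (h4 : ∀ a : A.unop, ev f (dgen (dgen a)) = ev g (dgen (dgen a))) : f = g :=
  hat_inj (hom_ext (fun a => ev_hat_eq (h1 a) (h3 a)) (fun a => ev_hat_eq (h2 a) (h4 a)))

theorem hom_ext₃ {X A : CommRingCat.{u}ᵒᵖ} {f g : X ⟶ T.obj (T.obj (T.obj A))}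
    (h1 : ∀ a : A.unop, ev f (gen (gen (gen a))) = ev g (gen (gen (gen a))))
    (h2 : ∀ a : A.unop, ev f (gen (gen (dgen a))) = ev g (gen (gen (dgen a))))
    (h3 : ∀ a : A.unop, ev f (gen (dgen (gen a))) = ev g (gen (dgen (gen a))))
    (h4 : ∀ a : A.unop, ev f (gen (dgen (dgen a))) = ev g (gen (dgen (dgen a))))
    (h5 : ∀ a : A.unop, ev f (dgen (gen (gen a))) = ev g (dgen (gen (gen a))))
    (h6 : ∀ a : A.unop, ev f (dgen (gen (dgen a))) = ev g (dgen (gen (dgen a))))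
    (h7 : ∀ a : A.unop, ev f (dgen (dgen (gen a))) = ev g (dgen (dgen (gen a))))
    (h8 : ∀ a : A.unop, ev f (dgen (dgen (dgen a))) = ev g (dgen (dgen (dgen a)))) : f = g :=
  hat_inj (hom_ext₂ (fun a => ev_hat_eq (h1 a) (h5 a)) (fun a => ev_hat_eq (h2 a) (h6 a))
    (fun a => ev_hat_eq (h3 a) (h7 a)) (fun a => ev_hat_eq (h4 a) (h8 a)))

theorem ell_proj (A : CommRingCat.{u}ᵒᵖ) : ell A ≫ T.map (p A) = p A ≫ zero A := by
  refine hom_ext (fun a => ?_) (fun a => ?_)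
  · simp only [ev_comp, ev_map_of, ev_p, ev_ell_gen_gen, ev_zero_of]
  · simp only [ev_comp, ev_map_d, ev_p, ev_ell_dgen_gen, ev_zero_d, map_zero]

theorem zero_natural {A B : CommRingCat.{u}ᵒᵖ} (f : A ⟶ B) : f ≫ zero B = zero A ≫ T.map f := by
  refine hom_ext (fun a => ?_) (fun a => ?_)
  · simp only [ev_comp, ev_map_of, ev_zero_of]
  · simp only [ev_comp, ev_map_d, ev_zero_d, map_zero]

theorem flip_proj (A : CommRingCat.{u}ᵒᵖ) : flip A ≫ p (T.obj A) = T.map (p A) := by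
  refine hom_ext (fun a => ?_) (fun a => ?_)
  · simp only [ev_comp, ev_map_of, ev_p, ev_flip_gen_gen]
  · simp only [ev_comp, ev_map_d, ev_p, ev_flip_gen_dgen]

/-- The square expressing the universality of the vertical lift is a pullback. -/
theorem universal (A : CommRingCat.{u}ᵒᵖ)
    (h : (π (p A) 0 ≫ ell A) ≫ T.map (p A) = (π (p A) 1 ≫ zero (T.obj A)) ≫ T.map (p A)) :
    IsPullback
      (mapPair T (p A) (π (p A) 0 ≫ ell A) (π (p A) 1 ≫ zero (T.obj A)) h ≫ T.map (add A))
      (π (p A) (0 : Fin 2) ≫ p A) (T.map (p A)) (zero A) := by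
  set ν := mapPair T (p A) (π (p A) 0 ≫ ell A) (π (p A) 1 ≫ zero (T.obj A)) h ≫ T.map (add A)
  have hν1 : ∀ a : A.unop, ev ν (gen (gen a)) = ev (π (p A) 0) (gen a) := fun a => by
    simp only [ν, ev_comp, ev_map_of, ev_add_of, ev_mapPair_fst_of, ev_ell_gen_gen]
  have hν2 : ∀ a : A.unop, ev ν (gen (dgen a)) = ev (π (p A) 1) (dgen a) := fun a => by
    simp only [ν, ev_comp, ev_map_of, ev_add_d, map_add, ev_mapPair_fst_of, ev_mapPair_snd_of,
      ev_ell_gen_dgen, ev_zero_of, map_zero, zero_add]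
  have hν3 : ∀ a : A.unop, ev ν (dgen (gen a)) = 0 := fun a => by
    simp only [ν, ev_comp, ev_map_d, ev_add_of, ev_mapPair_fst_d, ev_ell_dgen_gen, map_zero]
  have hν4 : ∀ a : A.unop, ev ν (dgen (dgen a)) = ev (π (p A) 0) (dgen a) := fun a => by
    simp only [ν, ev_comp, ev_map_d, ev_add_d, map_add, ev_mapPair_fst_d, ev_mapPair_snd_d,
      ev_ell_dgen_dgen, ev_zero_d, map_zero, add_zero]
  have hw : ν ≫ T.map (p A) = (π (p A) (0 : Fin 2) ≫ p A) ≫ zero A := by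
    refine hom_ext (fun a => ?_) (fun a => ?_)
    · simp only [ev_comp ν, ev_comp _ (zero A), ev_map_of, ev_p, hν1, ev_zero_of]
      rfl
    · simp only [ev_comp ν, ev_comp _ (zero A), ev_map_d, ev_p, hν3, ev_zero_d, map_zero]
  have hs1 : ∀ (s : PullbackCone (T.map (p A)) (zero A)) (a : A.unop),
      ev s.fst (gen (gen a)) = ev s.snd a := fun s a => by
    have := congrArg (fun k => ev k (gen a)) s.condition
    simpa only [ev_comp, ev_map_of, ev_p, ev_zero_of] using this
  have hs3 : ∀ (s : PullbackCone (T.map (p A)) (zero A)) (a : A.unop),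
      ev s.fst (dgen (gen a)) = 0 := fun s a => by
    have := congrArg (fun k => ev k (dgen a)) s.condition
    simpa only [ev_comp, ev_map_d, ev_p, ev_zero_d, map_zero] using this
  let k1 : ∀ s : PullbackCone (T.map (p A)) (zero A), s.pt ⟶ T.obj A := fun s =>
    mk (Y := T.obj A) (TanRing.lift (R := A.unop) (ev s.snd)
      ((ev s.fst).toAddMonoidHom.comp (dgen.comp dgen)) fun a b => by
        change ev s.fst (dgen (dgen (a * b))) =
          ev s.snd a * ev s.fst (dgen (dgen b)) + ev s.snd b * ev s.fst (dgen (dgen a))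
        simp only [dgen_mul, map_add, map_mul, hs1, hs3, mul_zero, add_zero])
  have hk1 : ∀ s a, ev (k1 s) (gen a) = ev s.snd a := fun s a => TanRing.lift_of _ _ _ a
  have hk2 : ∀ s a, ev (k1 s) (dgen a) = ev s.fst (dgen (dgen a)) := fun s a =>
    TanRing.lift_d _ _ _ a
  have hk : ∀ s, k1 s ≫ p A = (s.fst ≫ p (T.obj A)) ≫ p A := fun s => hom_ext₁ fun a => by
    simp only [ev_comp, ev_p, hk1, hs1]
  refine ⟨⟨hw⟩, ⟨PullbackCone.IsLimit.mk hw
    (fun s => pair (p A) (k1 s) (s.fst ≫ p (T.obj A)) (hk s)) (fun s => ?_) (fun s => ?_)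
    (fun s m hm1 hm2 => ?_)⟩⟩
  · refine hom_ext₂ (fun a => ?_) (fun a => ?_) (fun a => ?_) (fun a => ?_)
    · simp only [ev_comp _ ν, hν1, ev_pair_fst, hk1, hs1]
    · simp only [ev_comp _ ν, hν2, ev_pair_snd]
      rfl
    · simp only [ev_comp _ ν, hν3, map_zero, hs3]
    · simp only [ev_comp _ ν, hν4, ev_pair_fst, hk2]
  · refine hom_ext₁ fun a => ?_
    simp only [ev_comp, ev_p, ev_pair_fst, hk1]
  · refine fibrePow.hom_ext _ ?_ ?_
    · rw [pair_fst]
      refine hom_ext (fun a => ?_) (fun a => ?_)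
      · rw [hk1, ← hm2]
        rfl
      · rw [hk2, ← hm1, ev_comp, ev_comp, hν4]
    · rw [pair_snd]
      refine hom_ext (fun a => ?_) (fun a => ?_)
      · rw [← hm1]
        simp only [ev_comp _ (p (T.obj A)), ev_p, ev_comp _ ν, hν1, ev_comp _ (π (p A) 1)]
        rw [ev_π_of A 1 0]
      · rw [← hm1]
        simp only [ev_comp _ (p (T.obj A)), ev_p, ev_comp _ ν, hν2, ev_comp _ (π (p A) 1)]

/-- The tangent structure on `CRING^op`. -/
noncomputable def tangent : TangentStructure CommRingCat.{u}ᵒᵖ where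
  T := T
  p := p
  p_natural f := hom_ext₁ fun a => ev_map_of f a
  bundle := bundle
  add_natural f := by
    refine hom_ext (fun a => ?_) (fun a => ?_)
    · simp only [bundle, ev_comp, ev_add_of, ev_map_of, ev_pair_fst]
    · simp only [bundle, ev_comp, ev_add_d, map_add, ev_map_d, ev_pair_fst, ev_pair_snd]
  zero_natural := zero_natural
  ℓ := ell
  ℓ_natural f := by
    refine hom_ext₂ (fun a => ?_) (fun a => ?_) (fun a => ?_) (fun a => ?_) <;>
    simp only [ev_comp, ev_map_of, ev_map_d, ev_ell_gen_gen, ev_ell_gen_dgen, ev_ell_dgen_gen,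
      ev_ell_dgen_dgen, map_zero]
  c := flip
  c_natural f := by
    refine hom_ext₂ (fun a => ?_) (fun a => ?_) (fun a => ?_) (fun a => ?_) <;>
    simp only [ev_comp, ev_map_of, ev_map_d, ev_flip_gen_gen, ev_flip_gen_dgen, ev_flip_dgen_gen,
      ev_flip_dgen_dgen]
  ℓ_proj := ell_proj
  ℓ_add A := by
    refine hom_ext₂ (fun a => ?_) (fun a => ?_) (fun a => ?_) (fun a => ?_) <;>
    simp only [bundle, ev_comp, ev_map_of, ev_map_d, ev_add_of, ev_add_d, map_add,
      ev_mapPair_fst_of, ev_mapPair_fst_d, ev_mapPair_snd_of, ev_mapPair_snd_d,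
      ev_ell_gen_gen, ev_ell_gen_dgen, ev_ell_dgen_gen, ev_ell_dgen_dgen, map_zero, add_zero]
  ℓ_zero A := by
    refine hom_ext₂ (fun a => ?_) (fun a => ?_) (fun a => ?_) (fun a => ?_) <;>
    simp only [bundle, ev_comp, ev_map_of, ev_map_d, ev_zero_of, ev_zero_d,
      ev_ell_gen_gen, ev_ell_gen_dgen, ev_ell_dgen_gen, ev_ell_dgen_dgen, map_zero]
  c_proj := flip_proj
  c_add A := by
    refine hom_ext₂ (fun a => ?_) (fun a => ?_) (fun a => ?_) (fun a => ?_) <;>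
    simp only [bundle, ev_comp, ev_map_of, ev_map_d, ev_add_of, ev_add_d, map_add,
      ev_pair_fst, ev_pair_snd,
      ev_flip_gen_gen, ev_flip_gen_dgen, ev_flip_dgen_gen, ev_flip_dgen_dgen]
  c_zero A := by
    refine hom_ext₂ (fun a => ?_) (fun a => ?_) (fun a => ?_) (fun a => ?_) <;>
    simp only [bundle, ev_comp, ev_map_of, ev_map_d, ev_zero_of, ev_zero_d,
      ev_flip_gen_gen, ev_flip_gen_dgen, ev_flip_dgen_gen, ev_flip_dgen_dgen, map_zero]
  c_c A := by
    refine hom_ext₂ (fun a => ?_) (fun a => ?_) (fun a => ?_) (fun a => ?_) <;>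
    simp only [ev_comp, ev_flip_gen_gen, ev_flip_gen_dgen, ev_flip_dgen_gen, ev_flip_dgen_dgen] <;>
    rfl
  yang_baxter A := by
    refine hom_ext₃ (fun a => ?_) (fun a => ?_) (fun a => ?_) (fun a => ?_)
      (fun a => ?_) (fun a => ?_) (fun a => ?_) (fun a => ?_) <;>
    simp only [ev_comp, ev_map_of, ev_map_d, ev_flip_gen_gen, ev_flip_gen_dgen, ev_flip_dgen_gen,
      ev_flip_dgen_dgen]
  ℓ_ℓ A := by
    refine hom_ext₃ (fun a => ?_) (fun a => ?_) (fun a => ?_) (fun a => ?_)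
      (fun a => ?_) (fun a => ?_) (fun a => ?_) (fun a => ?_) <;>
    simp only [ev_comp, ev_map_of, ev_map_d, ev_ell_gen_gen, ev_ell_gen_dgen, ev_ell_dgen_gen,
      ev_ell_dgen_dgen, map_zero]
  ℓ_c A := by
    refine hom_ext₂ (fun a => ?_) (fun a => ?_) (fun a => ?_) (fun a => ?_) <;>
    simp only [ev_comp, ev_ell_gen_gen, ev_ell_gen_dgen, ev_ell_dgen_gen,
      ev_ell_dgen_dgen, ev_flip_gen_gen, ev_flip_gen_dgen, ev_flip_dgen_gen, ev_flip_dgen_dgen]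
  ℓ_c_c A := by
    refine hom_ext₃ (fun a => ?_) (fun a => ?_) (fun a => ?_) (fun a => ?_)
      (fun a => ?_) (fun a => ?_) (fun a => ?_) (fun a => ?_) <;>
    simp only [ev_comp, ev_map_of, ev_map_d, ev_ell_gen_gen, ev_ell_gen_dgen, ev_ell_dgen_gen,
      ev_ell_dgen_dgen, ev_flip_gen_gen, ev_flip_gen_dgen, ev_flip_dgen_gen, ev_flip_dgen_dgen,
      map_zero]
  universal A n := (universal A _).map (iterFunctor T n)

/-- `ℤ` is a terminal object of `CRING^op`. -/
noncomputable def isTerminalInt : IsTerminal (op (CommRingCat.of (ULift.{u} ℤ))) :=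
  terminalOpOfInitial CommRingCat.isInitial

instance : (tangent.{u}).IsCartesian where
  hasFiniteProducts := inferInstance
  isIso_prod A B := inferInstanceAs (IsIso (prodComparison T A B))
  isIso_terminal := inferInstanceAs (IsIso (terminalComparison T))

end CRingOp

/-! ### The abelian group of a differential bundle of affine schemes -/

namespace DifferentialBundle

open CRingOp

variable {A : CommRingCat.{u}ᵒᵖ}

/-- The derivation `D_λ : E → E`, `D_λ(x) = λ(d(x))`, induced by the lift `λ : T(E) → E` (written as
a ring morphism) of a differential bundle in `CRING^op`. -/
noncomputable def liftDerivation (𝓔 : DifferentialBundle tangent.{u} A) :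
    𝓔.E.unop →+ 𝓔.E.unop :=
  (ev 𝓔.lift).toAddMonoidHom.comp dgen

/-- The image of the derivation `D_λ`, as an abelian group. -/
noncomputable def liftImage (𝓔 : DifferentialBundle tangent.{u} A) : AddCommGrpCat.{u} :=
  AddCommGrpCat.of 𝓔.liftDerivation.range

theorem liftDerivation_hom {𝓔 𝓔' : DifferentialBundle tangent.{u} A} (f : 𝓔 ⟶ 𝓔')
    (x : 𝓔'.E.unop) :
    ev f.hom (𝓔'.liftDerivation x) = 𝓔.liftDerivation (ev f.hom x) :=
  (congrArg (fun k : 𝓔.E ⟶ T.obj 𝓔'.E => ev k (dgen x)) f.w_lift).trans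
    (congrArg (ev 𝓔.lift) (ev_map_d f.hom x))

/-- The functor sending a differential bundle in `CRING^op` to the abelian group `im(D_λ)`, and a
differential bundle morphism `f : 𝓔 ⟶ 𝓔'`, which is a ring morphism `E' → E`, to its restriction
`im(D_λ') → im(D_λ)`. -/
noncomputable def liftImageFunctor (A : CommRingCat.{u}ᵒᵖ) :
    DifferentialBundle tangent.{u} A ⥤ AddCommGrpCat.{u}ᵒᵖ where
  obj 𝓔 := op 𝓔.liftImage
  map {𝓔 𝓔'} f := (AddCommGrpCat.ofHom
    (((ev f.hom).toAddMonoidHom.comp 𝓔'.liftDerivation.range.subtype).codRestrict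
      𝓔.liftDerivation.range (by
        rintro ⟨_, x, rfl⟩
        exact ⟨_, (liftDerivation_hom f x).symm⟩))).op
  map_id _ := rfl
  map_comp _ _ := rfl

/-- The map on isomorphism classes induced by `𝓔 ↦ im(D_λ)`. -/
noncomputable def liftImageClass (A : CommRingCat.{u}ᵒᵖ) :
    Quotient (isIsomorphicSetoid (DifferentialBundle tangent.{u} A)) →
      Quotient (isIsomorphicSetoid AddCommGrpCat.{u}) :=
  Quotient.map liftImage fun _ _ ⟨e⟩ => ⟨((liftImageFunctor A).mapIso e).unop.symm⟩

end DifferentialBundle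

/-! ### Maps into the total object of a differential bundle -/

/-! Universality of the lift, restricted along `⟨1, q ≫ z⟩`, says that maps `X ⟶ E` are the maps `X
⟶ T(E)` that are vertical and based at the zero section (`exists_comp_lift_eq`,
`comp_lift_injective`). Over a terminal object of `CRING^op` verticality is automatic, since `T`
preserves the terminal object. A map `X ⟶ T(E)` is a ring morphism `E → X` together with a
derivation along it, and being based at zero fixes the morphism as the augmentation `ε : E → ℤ → X`.
Hence `f ↦ f ∘ D_λ` is a bijection from ring morphisms `E → X` to derivations `E → X` along `ε`.

`D_λ` is itself an idempotent derivation along the augmentation, so every such derivation `δ`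
satisfies `δ ∘ D_λ = δ` and is determined by its restriction to `im(D_λ)`. Conversely, the
augmentation takes integer values, so any additive map on `im(D_λ)`, composed with `D_λ`, is a
derivation. Ring morphisms out of `E` are thus additive maps out of `im(D_λ)`: morally, `E` is
`Sym(im(D_λ))`. The proof never builds this isomorphism. It deduces that `𝓔 ↦ im(D_λ)` is fully
faithful (`hom_ext_liftDerivation`, `exists_hom_of_liftImage`).

Essential surjectivity comes from `Sym(G)`: `T(Sym(G))` is free on the elements `g` and `d(g)`,
which gives universality of its lift, and the image of its derivation is the copy of `G` in degree
one (`symDerivation_range`). Bijectivity on isomorphism classes follows from the equivalence. -/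

namespace DifferentialBundle

section Factor

open fibrePow

variable {C : Type u} [Category.{v} C] {𝕋 : TangentStructure C} {A : C}
  (𝓔 : DifferentialBundle 𝕋 A)

/-- The map `E_2 ⟶ T(E)` of the universality of the lift. -/
noncomputable def liftSum : fibrePow 𝓔.q 2 ⟶ 𝕋.T.obj 𝓔.E :=
  mapPair 𝕋.T 𝓔.q (π 𝓔.q 0 ≫ 𝓔.lift) (π 𝓔.q 1 ≫ (𝕋.bundle 𝓔.E).zero)
    (by rw [Category.assoc, 𝓔.lift_map_proj, Category.assoc, ← 𝕋.zero_natural,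
          ← Category.assoc, π_proj 𝓔.q 0 1, Category.assoc]) ≫ 𝕋.T.map 𝓔.bundle.add

theorem isPullback_liftSum : IsPullback 𝓔.liftSum (π 𝓔.q (0 : Fin 2) ≫ 𝓔.q) (𝕋.T.map 𝓔.q)
    (𝕋.bundle A).zero :=
  𝓔.universal 0

/-- By naturality of `p`, the base point of the sum is the sum of the base points. The lifted
component is based at zero and the other is based at its own point, so the unit law leaves the
second projection. -/
theorem liftSum_p : 𝓔.liftSum ≫ 𝕋.p 𝓔.E = π 𝓔.q 1 := by
  have h : (π 𝓔.q (0 : Fin 2) ≫ 𝓔.q) ≫ 𝓔.bundle.zero =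
      π 𝓔.q 1 ≫ 𝓔.q ≫ 𝓔.bundle.zero := by
    rw [π_proj 𝓔.q 0 1, Category.assoc]
  have h2 := congrArg (π 𝓔.q (1 : Fin 2) ≫ ·) 𝓔.bundle.zero_add
  simp only [Category.comp_id] at h2
  rw [liftSum, Category.assoc, 𝕋.p_natural, ← Category.assoc]
  refine Eq.trans ?_ h2
  rw [← Category.assoc]
  congr 1
  refine fibrePow.hom_ext _ ?_ ?_
  · rw [Category.assoc, ← 𝕋.p_natural, ← Category.assoc, mapPair_fst, Category.assoc,
      𝓔.lift_proj, Category.assoc, pair_fst, ← h, Category.assoc]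
  · rw [Category.assoc, ← 𝕋.p_natural, ← Category.assoc, mapPair_snd, Category.assoc,
      (𝕋.bundle _).zero_proj, Category.assoc, pair_snd]

/-- The map `⟨1, q ≫ z⟩ : E ⟶ E_2`. -/
noncomputable def pairZero : 𝓔.E ⟶ fibrePow 𝓔.q 2 :=
  pair 𝓔.q (𝟙 𝓔.E) (𝓔.q ≫ 𝓔.bundle.zero) (by simp [𝓔.bundle.zero_proj])

theorem pairZero_fst : 𝓔.pairZero ≫ π 𝓔.q 0 = 𝟙 𝓔.E := pair_fst _ _ _ _

theorem pairZero_snd : 𝓔.pairZero ≫ π 𝓔.q 1 = 𝓔.q ≫ 𝓔.bundle.zero := pair_snd _ _ _ _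

theorem pairZero_add : 𝓔.pairZero ≫ 𝓔.bundle.add = 𝟙 𝓔.E := 𝓔.bundle.add_zero

/-- Compare with `lift ≫ T(pairZero) ≫ T(σ) = lift`. The two pairings into `T(E_2)` agree because
`lift ≫ T(q ≫ z)` equals `q ≫ z` followed by the zero of `T(E)`. -/
theorem pairZero_liftSum : 𝓔.pairZero ≫ 𝓔.liftSum = 𝓔.lift := by
  have h2 := congrArg (𝓔.lift ≫ 𝕋.T.map ·) 𝓔.pairZero_add
  simp only [𝕋.T.map_id, Category.comp_id] at h2
  rw [liftSum, ← Category.assoc]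
  refine Eq.trans ?_ h2
  rw [𝕋.T.map_comp, ← Category.assoc]
  congr 1
  refine fibrePow.map_hom_ext _ _ ?_ ?_
  · rw [Category.assoc, mapPair_fst, ← Category.assoc, pairZero_fst, Category.assoc,
      ← 𝕋.T.map_comp, pairZero_fst, 𝕋.T.map_id, Category.id_comp, Category.comp_id]
  · rw [Category.assoc, mapPair_snd, ← Category.assoc, pairZero_snd, Category.assoc,
      Category.assoc, ← 𝕋.T.map_comp, pairZero_snd, 𝕋.T.map_comp, ← Category.assoc 𝓔.lift,
      𝓔.lift_map_proj, Category.assoc, 𝕋.zero_natural]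

/-- A map `X ⟶ T(E)` that is vertical and lies over the zero section factors through the lift. -/
theorem exists_comp_lift_eq {X : C} (h : X ⟶ 𝕋.T.obj 𝓔.E) (k : X ⟶ A)
    (hq : h ≫ 𝕋.T.map 𝓔.q = k ≫ (𝕋.bundle A).zero)
    (hp : h ≫ 𝕋.p 𝓔.E = k ≫ 𝓔.bundle.zero) : ∃ f : X ⟶ 𝓔.E, f ≫ 𝓔.lift = h := by
  -- The factorization through `E_2` is a pair. By `liftSum_p` its second component is the base
  -- point of `h`, hence zero, so the first component alone already gives `h`.
  let m := 𝓔.isPullback_liftSum.lift h k hq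
  have hm : m ≫ 𝓔.liftSum = h := 𝓔.isPullback_liftSum.lift_fst h k hq
  have hk : (m ≫ π 𝓔.q 0) ≫ 𝓔.q = k := by
    rw [Category.assoc]; exact 𝓔.isPullback_liftSum.lift_snd h k hq
  refine ⟨m ≫ π 𝓔.q 0, ?_⟩
  rw [← pairZero_liftSum, ← hm, ← Category.assoc]
  congr 1
  refine fibrePow.hom_ext _ ?_ ?_
  · rw [Category.assoc, pairZero_fst, Category.comp_id]
  · rw [Category.assoc, pairZero_snd, ← Category.assoc, hk, ← hp, ← hm, Category.assoc, liftSum_p]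

/-- `pairZero` is a split monomorphism, and maps into `E_2` are separated by the two legs of the
universality square. -/
theorem comp_lift_injective {X : C} {f g : X ⟶ 𝓔.E} (hq : f ≫ 𝓔.q = g ≫ 𝓔.q)
    (h : f ≫ 𝓔.lift = g ≫ 𝓔.lift) : f = g := by
  have hpair : f ≫ 𝓔.pairZero =
      g ≫ 𝓔.pairZero := by
    refine 𝓔.isPullback_liftSum.hom_ext ?_ ?_
    · rw [Category.assoc, pairZero_liftSum, h, Category.assoc, pairZero_liftSum]
    · rw [← Category.assoc, ← Category.assoc, Category.assoc f, Category.assoc g, pairZero_fst,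
        Category.comp_id, Category.comp_id, hq]
  simpa only [Category.assoc, pairZero_fst, Category.comp_id] using congrArg (· ≫ π 𝓔.q 0) hpair

end Factor

end DifferentialBundle

/-! ### Differential objects in the opposite of the category of commutative rings -/

/-- The ring is isomorphic to `ℤ`. This lets multiplication by augmentation values be read as
integer multiples, with which every additive map commutes. -/
theorem CRingOp.exists_intCast_eq {A : CommRingCat.{u}ᵒᵖ} (hA : IsTerminal A) (a : A.unop) :
    ∃ n : ℤ, (n : A.unop) = a := by
  let e := hA.uniqueUpToIso isTerminalInt
  refine ⟨(ev e.inv a : ULift ℤ).down, ?_⟩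
  have h : ev e.hom (ev e.inv a) = a := congrArg (fun k : A ⟶ A => ev k a) e.hom_inv_id
  rw [← map_intCast (ev e.hom)]
  refine (congrArg (ev e.hom) (ULift.ext _ _ ?_)).trans h
  exact Int.cast_id

namespace DifferentialBundle

open CRingOp

variable {A : CommRingCat.{u}ᵒᵖ}

/-! ### Identities satisfied by `D_λ` -/

section LiftDerivation

variable (𝓔 : DifferentialBundle tangent.{u} A)

theorem ev_lift_gen (a : 𝓔.E.unop) :
    ev 𝓔.lift (gen a) = ev 𝓔.q (ev 𝓔.bundle.zero a) :=
  congrArg (fun k : 𝓔.E ⟶ 𝓔.E => ev k a) 𝓔.lift_proj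

theorem liftDerivation_mul (a b : 𝓔.E.unop) :
    𝓔.liftDerivation (a * b) = ev 𝓔.q (ev 𝓔.bundle.zero a) * 𝓔.liftDerivation b +
      ev 𝓔.q (ev 𝓔.bundle.zero b) * 𝓔.liftDerivation a := by
  rw [← ev_lift_gen, ← ev_lift_gen]
  let l : 𝓔.E ⟶ T.obj 𝓔.E := 𝓔.lift
  change ev l (dgen (a * b)) = ev l (gen a) * ev l (dgen b) + ev l (gen b) * ev l (dgen a)
  rw [dgen_mul, map_add, map_mul, map_mul]

theorem ev_zero_liftDerivation (a : 𝓔.E.unop) :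
    ev 𝓔.bundle.zero (𝓔.liftDerivation a) = 0 :=
  (congrArg (fun k : A ⟶ T.obj 𝓔.E => ev k (dgen a)) 𝓔.lift_zero).trans
    ((congrArg (ev 𝓔.bundle.zero) (ev_zero_d 𝓔.E a)).trans (map_zero _))

/-- Evaluate the compatibility `lift_lift` on `d'd(a)`: the vertical lift sends it to `d(a)`, while
`T(λ)` turns it into `d(D_λ(a))`. -/
theorem liftDerivation_liftDerivation (a : 𝓔.E.unop) :
    𝓔.liftDerivation (𝓔.liftDerivation a) = 𝓔.liftDerivation a :=
  (congrArg (ev 𝓔.lift) (ev_map_d (Y := T.obj 𝓔.E) 𝓔.lift (dgen a))).symm.trans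
    ((congrArg (fun k : 𝓔.E ⟶ T.obj (T.obj 𝓔.E) => ev k (dgen (dgen a))) 𝓔.lift_lift).trans
      (congrArg (ev 𝓔.lift) (ev_ell_dgen_dgen 𝓔.E a)))

end LiftDerivation

/-! ### Universal property of `D_λ` and full faithfulness -/

variable (hA : IsTerminal A) (𝓔 : DifferentialBundle tangent.{u} A)

include hA

/-- After composing with the lift, the generators `a` go to their augmentations, which no choice of
map into `E` can alter over a terminal object. Only the values on `d(a)`, that is on `im(D_λ)`,
remain. -/
theorem hom_ext_liftDerivation {X : CommRingCat.{u}ᵒᵖ} {f g : X ⟶ 𝓔.E}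
    (h : ∀ a, ev f (𝓔.liftDerivation a) = ev g (𝓔.liftDerivation a)) : f = g := by
  refine 𝓔.comp_lift_injective (hA.hom_ext _ _) (CRingOp.hom_ext (fun a => ?_) h)
  have hq : f ≫ 𝓔.q = g ≫ 𝓔.q := hA.hom_ext _ _
  change ev f (ev 𝓔.lift (gen a)) = ev g (ev 𝓔.lift (gen a))
  rw [ev_lift_gen, ← ev_comp f, ← ev_comp g, hq]

/-- The derivation `D_λ` is universal among the derivations along the augmentation `z`. -/
theorem exists_ev_liftDerivation_eq {X : CommRingCat.{u}ᵒᵖ} (k : X ⟶ A)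
    (δ : 𝓔.E.unop →+ X.unop)
    (h : ∀ a b, δ (a * b) = ev k (ev 𝓔.bundle.zero a) * δ b + ev k (ev 𝓔.bundle.zero b) * δ a) :
    ∃ f : X ⟶ 𝓔.E, ∀ a, ev f (𝓔.liftDerivation a) = δ a := by
  let t : X ⟶ T.obj 𝓔.E := CRingOp.mk (Y := T.obj 𝓔.E) (TanRing.lift (ev (k ≫ 𝓔.bundle.zero)) δ h)
  -- `T(A)` is terminal too, so the verticality condition on `t` is automatic.
  have hTA : IsTerminal (T.obj A) := hA.isTerminalObj T A
  obtain ⟨f, hf⟩ := 𝓔.exists_comp_lift_eq t k (hTA.hom_ext _ _)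
    (hom_ext₁ fun a => TanRing.lift_of _ _ _ a)
  exact ⟨f, fun a => (congrArg (fun k : X ⟶ T.obj 𝓔.E => ev k (dgen a)) hf).trans
    (TanRing.lift_d _ _ _ a)⟩

/-- Write `δ = f ∘ D_λ` by universality and use that `D_λ` is idempotent. -/
theorem derivation_liftDerivation {X : CommRingCat.{u}ᵒᵖ} (k : X ⟶ A)
    (δ : 𝓔.E.unop →+ X.unop)
    (h : ∀ a b, δ (a * b) = ev k (ev 𝓔.bundle.zero a) * δ b + ev k (ev 𝓔.bundle.zero b) * δ a)
    (a : 𝓔.E.unop) : δ (𝓔.liftDerivation a) = δ a := by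
  obtain ⟨f, hf⟩ := exists_ev_liftDerivation_eq hA 𝓔 k δ h
  rw [← hf, ← hf, liftDerivation_liftDerivation]

theorem liftImageFunctor_faithful : (liftImageFunctor A).Faithful where
  map_injective {𝓔 𝓔'} f g h := by
    refine Hom.ext (hom_ext_liftDerivation hA 𝓔' fun a => ?_)
    exact congrArg (fun k : op 𝓔.liftImage ⟶ op 𝓔'.liftImage =>
      (k.unop.hom ⟨𝓔'.liftDerivation a, a, rfl⟩).1) h

/-- The additive map `g ∘ D_λ'` is a derivation along the augmentation, so universality gives a ring
morphism extending `g`. The work is in showing that it respects the lifts. -/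
theorem exists_hom_of_liftImage (𝓔 𝓔' : DifferentialBundle tangent.{u} A)
    (g : 𝓔'.liftDerivation.range →+ 𝓔.liftDerivation.range) :
    ∃ f : 𝓔 ⟶ 𝓔', ∀ x : 𝓔'.liftDerivation.range, ev f.hom x = g x := by
  let δ : 𝓔'.E.unop →+ 𝓔.E.unop :=
    𝓔.liftDerivation.range.subtype.comp (g.comp 𝓔'.liftDerivation.rangeRestrict)
  have hδ (a b) : δ (a * b) = ev 𝓔.q (ev 𝓔'.bundle.zero a) * δ b +
      ev 𝓔.q (ev 𝓔'.bundle.zero b) * δ a := by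
    obtain ⟨m, hm⟩ := exists_intCast_eq hA (ev 𝓔'.bundle.zero a)
    obtain ⟨n, hn⟩ := exists_intCast_eq hA (ev 𝓔'.bundle.zero b)
    have hab : 𝓔'.liftDerivation.rangeRestrict (a * b) =
        m • 𝓔'.liftDerivation.rangeRestrict b + n • 𝓔'.liftDerivation.rangeRestrict a := by
      refine Subtype.ext ((𝓔'.liftDerivation_mul a b).trans ?_)
      rw [← hm, ← hn, map_intCast, map_intCast, ← zsmul_eq_mul, ← zsmul_eq_mul]
      rfl
    rw [← hm, ← hn, map_intCast, map_intCast, ← zsmul_eq_mul, ← zsmul_eq_mul]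
    change (g (𝓔'.liftDerivation.rangeRestrict (a * b))).1 = _
    rw [hab, map_add, map_zsmul, map_zsmul]
    rfl
  obtain ⟨f, hf⟩ := exists_ev_liftDerivation_eq hA 𝓔' 𝓔.q δ hδ
  -- The morphism preserves augmentations: both sides kill `im(D_λ')`, because the values of `g` lie
  -- in `im(D_λ)`, which the zero section kills.
  have hz : 𝓔.bundle.zero ≫ f = 𝓔'.bundle.zero := by
    refine hom_ext_liftDerivation hA 𝓔' fun a => ?_
    obtain ⟨y, hy⟩ := (g (𝓔'.liftDerivation.rangeRestrict a)).2
    rw [ev_comp, hf, ev_zero_liftDerivation]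
    change ev 𝓔.bundle.zero ((g (𝓔'.liftDerivation.rangeRestrict a)).1) = 0
    rw [← hy, ev_zero_liftDerivation]
  have hz' (a) : ev 𝓔.bundle.zero (ev f a) = ev 𝓔'.bundle.zero a :=
    congrArg (fun k : A ⟶ 𝓔'.E => ev k a) hz
  -- By `hz`, `D_λ ∘ f` is again a derivation along the augmentation, so it may be computed after
  -- `D_λ'`. There `f` takes the value `δ a`, which lies in `im(D_λ)` and is fixed by `D_λ`.
  have hD (a) : 𝓔.liftDerivation (ev f a) = δ a := by
    have := derivation_liftDerivation hA 𝓔' 𝓔.q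
      (𝓔.liftDerivation.comp (ev f).toAddMonoidHom) (fun a b => by
        change 𝓔.liftDerivation (ev f (a * b)) = _ * 𝓔.liftDerivation (ev f b) +
          _ * 𝓔.liftDerivation (ev f a)
        rw [map_mul, liftDerivation_mul, hz', hz']) a
    refine this.symm.trans ?_
    change 𝓔.liftDerivation (ev f (𝓔'.liftDerivation a)) = _
    rw [hf]
    change 𝓔.liftDerivation ((g (𝓔'.liftDerivation.rangeRestrict a)).1) =
      (g (𝓔'.liftDerivation.rangeRestrict a)).1
    obtain ⟨y, hy⟩ := (g (𝓔'.liftDerivation.rangeRestrict a)).2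
    rw [← hy, liftDerivation_liftDerivation]
  refine ⟨⟨f, hA.hom_ext _ _, CRingOp.hom_ext (fun a => ?_) (fun a => ?_)⟩, ?_⟩
  · change ev f (ev 𝓔'.lift (gen a)) = ev 𝓔.lift (ev (T.map f) (gen a))
    rw [ev_map_of, ev_lift_gen, ev_lift_gen, hz', ← ev_comp f, hA.hom_ext (f ≫ 𝓔'.q) 𝓔.q]
  · refine (hf a).trans ((hD a).symm.trans ?_)
    exact (congrArg (ev 𝓔.lift) (ev_map_d f a)).symm
  · rintro ⟨_, a, rfl⟩
    exact hf a

theorem liftImageFunctor_full : (liftImageFunctor A).Full where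
  map_surjective {𝓔 𝓔'} g := by
    obtain ⟨f, hf⟩ := exists_hom_of_liftImage hA 𝓔 𝓔' g.unop.hom
    refine ⟨f, Quiver.Hom.unop_inj (AddCommGrpCat.hom_ext (AddMonoidHom.ext fun x => ?_))⟩
    exact Subtype.ext (hf x)

end DifferentialBundle

/-! ### The differential object of an abelian group -/

namespace CRingOp

open fibrePow

/-! ### Maps out of the rings `Sym(G)`, `T(Sym(G))` and `T(T(Sym(G)))` -/

section SymObj

variable (G : Type u) [AddCommGroup G]

/-- The symmetric algebra of an abelian group, as an object of `CRING^op`. -/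
noncomputable def symObj : CommRingCat.{u}ᵒᵖ := op (CommRingCat.of (SymmetricAlgebra ℤ G))

variable {G}

/-- The generators of the symmetric algebra. -/
noncomputable def symGen : G →+ (symObj G).unop := (SymmetricAlgebra.ι ℤ G).toAddMonoidHom

/-- The map to `symObj G` given by the images of the generators. -/
noncomputable def symLift {X : CommRingCat.{u}ᵒᵖ} (f : G →+ X.unop) : X ⟶ symObj G :=
  mk (Y := symObj G) (SymmetricAlgebra.lift (A := X.unop) f.toIntLinearMap).toRingHom

theorem ev_symLift {X : CommRingCat.{u}ᵒᵖ} (f : G →+ X.unop) (g : G) :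
    ev (symLift f) (symGen g) = f g :=
  SymmetricAlgebra.lift_ι_apply (A := X.unop) f.toIntLinearMap g

theorem sym_hom_ext {X : CommRingCat.{u}ᵒᵖ} {f f' : X ⟶ symObj G}
    (h : ∀ g : G, ev f (symGen g) = ev f' (symGen g)) : f = f' := by
  refine hom_ext₁ fun a => ?_
  let F : SymmetricAlgebra ℤ G →+* X.unop := ev f
  let F' : SymmetricAlgebra ℤ G →+* X.unop := ev f'
  have : F.toIntAlgHom = F'.toIntAlgHom :=
    SymmetricAlgebra.algHom_ext (LinearMap.ext fun g => h g)
  exact congrArg (fun k : SymmetricAlgebra ℤ G →ₐ[ℤ] X.unop => k a) this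

/-- Passing to dual numbers through `hat` removes the `T` and leaves ring morphisms out of `Sym(G)`.
-/
theorem sym_hom_ext_T {X : CommRingCat.{u}ᵒᵖ} {f f' : X ⟶ T.obj (symObj G)}
    (h : ∀ g : G, ev f (gen (symGen g)) = ev f' (gen (symGen g)))
    (h' : ∀ g : G, ev f (dgen (symGen g)) = ev f' (dgen (symGen g))) : f = f' :=
  hat_inj (sym_hom_ext fun g => ev_hat_eq (h g) (h' g))

theorem sym_hom_ext_T_T {X : CommRingCat.{u}ᵒᵖ} {f f' : X ⟶ T.obj (T.obj (symObj G))}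
    (h1 : ∀ g : G, ev f (gen (gen (symGen g))) = ev f' (gen (gen (symGen g))))
    (h2 : ∀ g : G, ev f (gen (dgen (symGen g))) = ev f' (gen (dgen (symGen g))))
    (h3 : ∀ g : G, ev f (dgen (gen (symGen g))) = ev f' (dgen (gen (symGen g))))
    (h4 : ∀ g : G, ev f (dgen (dgen (symGen g))) = ev f' (dgen (dgen (symGen g)))) : f = f' :=
  hat_inj (sym_hom_ext_T (fun g => ev_hat_eq (h1 g) (h3 g)) fun g => ev_hat_eq (h2 g) (h4 g))

/-- The map `X ⟶ T(symObj G)` given by the images of the generators and of their differentials. -/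
noncomputable def symLiftT {X : CommRingCat.{u}ᵒᵖ} (f f' : G →+ X.unop) :
    X ⟶ T.obj (symObj G) :=
  mk (Y := T.obj (symObj G)) (TanRing.homEquiv.symm
    (ev (symLift (X := op (CommRingCat.of (DualNumber X.unop)))
      ((TrivSqZeroExt.inlHom X.unop X.unop).toAddMonoidHom.comp f +
        (TrivSqZeroExt.inrHom X.unop X.unop).toAddMonoidHom.comp f'))))

theorem ev_symLiftT_gen {X : CommRingCat.{u}ᵒᵖ} (f f' : G →+ X.unop) (g : G) :
    ev (symLiftT f f') (gen (symGen g)) = f g := by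
  refine (TanRing.homEquiv_symm_of _ _).trans ?_
  rw [ev_symLift]
  exact add_zero _

theorem ev_symLiftT_dgen {X : CommRingCat.{u}ᵒᵖ} (f f' : G →+ X.unop) (g : G) :
    ev (symLiftT f f') (dgen (symGen g)) = f' g := by
  refine (TanRing.homEquiv_symm_d _ _).trans ?_
  rw [ev_symLift]
  exact zero_add _

/-- The map `G → Sym(G)` has a retraction. -/
theorem symGen_injective : Function.Injective (symGen (G := G)) := by
  -- The retraction passes through the square-zero extension `ℤ ⊕ G`, whose ring structure needs a
  -- right action of `ℤ` as well.
  let _ : Module ℤᵐᵒᵖ G := Module.compHom G ((RingHom.id ℤ).fromOpposite mul_comm)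
  have _ : IsCentralScalar ℤ G := ⟨fun _ _ => rfl⟩
  let F := SymmetricAlgebra.lift (A := TrivSqZeroExt ℤ G) (TrivSqZeroExt.inrHom ℤ G)
  refine Function.LeftInverse.injective (g := fun x => (F x).snd) fun g => ?_
  exact congrArg TrivSqZeroExt.snd (SymmetricAlgebra.lift_ι_apply _ g)

end SymObj

/-! ### The differential bundle structure on `Sym(G)` -/

section SymBundle

variable {A : CommRingCat.{u}ᵒᵖ} (hA : IsTerminal A) (G : Type u) [AddCommGroup G]

/-- The projection of `symObj G`. -/
noncomputable def symProj : symObj G ⟶ A := hA.from _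

/-- The zero of `symObj G`. -/
noncomputable def symZero (A : CommRingCat.{u}ᵒᵖ) : A ⟶ symObj G := symLift 0

/-- The sum of `symObj G`. -/
noncomputable def symAdd : fibrePow (symProj hA G) 2 ⟶ symObj G :=
  symLift ((ev (π (symProj hA G) 0)).toAddMonoidHom.comp symGen +
    (ev (π (symProj hA G) 1)).toAddMonoidHom.comp symGen)

/-- The lift of `symObj G`. -/
noncomputable def symVert : symObj G ⟶ T.obj (symObj G) := symLiftT 0 symGen

variable {G} (g : G)

theorem ev_symZero : ev (symZero G A) (symGen g) = 0 := ev_symLift _ g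

theorem ev_symAdd : ev (symAdd hA G) (symGen g) =
    ev (π (symProj hA G) 0) (symGen g) + ev (π (symProj hA G) 1) (symGen g) := ev_symLift _ g

theorem ev_symVert_gen : ev (symVert G) (gen (symGen g)) = 0 := ev_symLiftT_gen _ _ g

theorem ev_symVert_dgen : ev (symVert G) (dgen (symGen g)) = symGen g := ev_symLiftT_dgen _ _ g

variable (G)

/-- The additive bundle structure on `symObj G`. -/
noncomputable def symAdditive : AdditiveBundle (symProj hA G) where
  add := symAdd hA G
  zero := symZero G A
  add_proj _ := hA.hom_ext _ _
  zero_proj := hA.hom_ext _ _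
  add_assoc := sym_hom_ext fun g => by
    simp only [ev_comp, ev_symAdd, map_add, ev_pair_fst, ev_pair_snd, add_assoc]
  zero_add := sym_hom_ext fun g => by
    simp only [ev_comp, ev_symAdd, map_add, ev_pair_fst, ev_pair_snd, ev_symZero, map_zero]
    exact zero_add _
  add_zero := sym_hom_ext fun g => by
    simp only [ev_comp, ev_symAdd, map_add, ev_pair_fst, ev_pair_snd, ev_symZero, map_zero]
    exact add_zero _
  add_comm := sym_hom_ext fun g => by
    simp only [ev_comp, ev_symAdd, map_add, ev_pair_fst, ev_pair_snd]
    exact add_comm _ _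

theorem isTerminalTObj_hom_ext {X : CommRingCat.{u}ᵒᵖ} (hA : IsTerminal A) (f g : X ⟶ T.obj A) :
    f = g :=
  (hA.isTerminalObj T A).hom_ext f g

theorem symVert_p : symVert G ≫ p (symObj G) = symProj hA G ≫ symZero G A :=
  sym_hom_ext fun g => by
    simp only [ev_comp, ev_p, ev_symVert_gen, ev_symZero, map_zero]

/-- Both `A` and `T(A)` are terminal, so the square is a pullback exactly when its top map is
invertible. As a ring morphism that map sends `g` and `d(g)` to the second and first copies of `g`,
so it matches free generators with free generators. -/
theorem sym_universal
    (h : (π (symProj hA G) 0 ≫ symVert G) ≫ T.map (symProj hA G) =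
      (π (symProj hA G) 1 ≫ zero (symObj G)) ≫ T.map (symProj hA G)) :
    IsPullback
      (mapPair T (symProj hA G) (π (symProj hA G) 0 ≫ symVert G)
        (π (symProj hA G) 1 ≫ zero (symObj G)) h ≫ T.map (symAdd hA G))
      (π (symProj hA G) (0 : Fin 2) ≫ symProj hA G) (T.map (symProj hA G)) (zero A) := by
  set ν := mapPair T (symProj hA G) (π (symProj hA G) 0 ≫ symVert G)
    (π (symProj hA G) 1 ≫ zero (symObj G)) h ≫ T.map (symAdd hA G)
  have hν1 (g : G) : ev ν (gen (symGen g)) = ev (π (symProj hA G) 1) (symGen g) := by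
    simp only [ν, ev_comp, ev_map_of, ev_symAdd, map_add, ev_mapPair_fst_of, ev_mapPair_snd_of,
      ev_symVert_gen, ev_zero_of, map_zero, zero_add]
  have hν2 (g : G) : ev ν (dgen (symGen g)) = ev (π (symProj hA G) 0) (symGen g) := by
    simp only [ν, ev_comp, ev_map_d, ev_symAdd, map_add, ev_mapPair_fst_d, ev_mapPair_snd_d,
      ev_symVert_dgen, ev_zero_d, map_zero, add_zero]
  have hw : ν ≫ T.map (symProj hA G) =
      (π (symProj hA G) (0 : Fin 2) ≫ symProj hA G) ≫ zero A :=
    isTerminalTObj_hom_ext hA _ _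
  refine ⟨⟨hw⟩, ⟨PullbackCone.IsLimit.mk hw
    (fun s => pair (symProj hA G)
      (symLift ((ev s.fst).toAddMonoidHom.comp (dgen.comp symGen)))
      (symLift ((ev s.fst).toAddMonoidHom.comp (gen.toAddMonoidHom.comp symGen)))
      (hA.hom_ext _ _)) (fun s => ?_) (fun s => hA.hom_ext _ _) (fun s m hm1 hm2 => ?_)⟩⟩
  · refine sym_hom_ext_T (fun g => ?_) (fun g => ?_)
    · rw [ev_comp, hν1, ev_pair_snd, ev_symLift]
      rfl
    · rw [ev_comp, hν2, ev_pair_fst, ev_symLift]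
      rfl
  · refine fibrePow.hom_ext _ (sym_hom_ext fun g => ?_) (sym_hom_ext fun g => ?_)
    · rw [pair_fst, ev_comp, ev_symLift, ← hν2, ← ev_comp, hm1]
      rfl
    · rw [pair_snd, ev_comp, ev_symLift, ← hν1, ← ev_comp, hm1]
      rfl

/-- The differential object with total ring the symmetric algebra of an abelian group. -/
noncomputable def symBundle : DifferentialBundle tangent.{u} A where
  E := symObj G
  q := symProj hA G
  hasFibrePowers := inferInstance
  preserves := inferInstanceAs (IteratesPreserveFibrePowers T (symProj hA G))
  bundle := symAdditive hA G
  lift := symVert G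
  lift_map_proj := isTerminalTObj_hom_ext hA _ _
  lift_map_add := by
    refine sym_hom_ext_T (fun g => ?_) (fun g => ?_)
    · simp only [symAdditive, tangent, ev_comp, ev_map_of, ev_symAdd, map_add,
        ev_mapPair_fst_of, ev_mapPair_snd_of, ev_symVert_gen, map_zero, add_zero]
    · simp only [symAdditive, tangent, ev_comp, ev_map_d, ev_symAdd, map_add,
        ev_mapPair_fst_d, ev_mapPair_snd_d, ev_symVert_dgen]
  lift_map_zero := by
    refine sym_hom_ext_T (fun g => ?_) (fun g => ?_)
    · simp only [symAdditive, tangent, bundle, ev_comp, ev_map_of, ev_symVert_gen, ev_symZero,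
        map_zero]
    · simp only [symAdditive, tangent, bundle, ev_comp, ev_map_d, ev_symVert_dgen, ev_symZero,
        map_zero]
  lift_proj := symVert_p hA G
  lift_add := by
    refine sym_hom_ext_T (fun g => ?_) (fun g => ?_)
    · simp only [symAdditive, tangent, bundle, ev_comp, ev_add_of, ev_pair_fst, ev_symVert_gen,
        map_zero]
    · simp only [symAdditive, tangent, bundle, ev_comp, ev_add_d, ev_symAdd, map_add,
        ev_pair_fst, ev_pair_snd, ev_symVert_dgen]
  lift_zero := by
    refine sym_hom_ext_T (fun g => ?_) (fun g => ?_)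
    · simp only [symAdditive, tangent, bundle, ev_comp, ev_zero_of, ev_symVert_gen, ev_symZero,
        map_zero]
    · simp only [symAdditive, tangent, bundle, ev_comp, ev_zero_d, ev_symVert_dgen, ev_symZero,
        map_zero]
  lift_lift := by
    refine sym_hom_ext_T_T (fun g => ?_) (fun g => ?_) (fun g => ?_) (fun g => ?_)
    · simp only [tangent, ev_comp, ev_map_of, ev_ell_gen_gen, ev_symVert_gen, map_zero]
    · simp only [tangent, ev_comp, ev_map_of, ev_ell_gen_dgen, ev_symVert_gen, ev_symVert_dgen,
        map_zero]
    · simp only [tangent, ev_comp, ev_map_d, ev_ell_dgen_gen, ev_symVert_gen, map_zero]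
    · simp only [tangent, ev_comp, ev_map_d, ev_ell_dgen_dgen, ev_symVert_dgen]
  -- The iterates of `T` preserve pullbacks, because `T` is a right adjoint on `CRING^op`.
  universal n := (sym_universal hA G _).map (iterFunctor T n)

end SymBundle

end CRingOp

/-! ### The image of the derivation of `Sym(G)` -/

namespace CRingOp

variable {A : CommRingCat.{u}ᵒᵖ} (hA : IsTerminal A) (G : Type u) [AddCommGroup G]

theorem sym_induction {motive : (symObj G).unop → Prop} (intCast : ∀ n : ℤ, motive n)
    (symGen : ∀ g : G, motive (symGen g)) (mul : ∀ a b, motive a → motive b → motive (a * b))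
    (add : ∀ a b, motive a → motive b → motive (a + b)) (a : (symObj G).unop) : motive a :=
  SymmetricAlgebra.induction (R := ℤ) (M := G) (motive := motive)
    (fun n => (eq_intCast (algebraMap ℤ (SymmetricAlgebra ℤ G)) n).symm ▸ intCast n)
    symGen mul add a

/-- The derivation of the symmetric algebra induced by the lift of `symBundle hA G`. -/
noncomputable def symDerivation : (symObj G).unop →+ (symObj G).unop :=
  (symBundle hA G).liftDerivation

theorem symDerivation_symGen (g : G) : symDerivation hA G (symGen g) = symGen g :=
  ev_symVert_dgen g

/-- The coefficients are the augmentations of `a` and `b`. Only their being integers matters: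
products then contribute nothing new to the image. -/
theorem symDerivation_mul (a b : (symObj G).unop) :
    ∃ m n : ℤ, symDerivation hA G (a * b) =
      m • symDerivation hA G b + n • symDerivation hA G a := by
  obtain ⟨m, hm⟩ := exists_intCast_eq hA (ev (symZero G A) a)
  obtain ⟨n, hn⟩ := exists_intCast_eq hA (ev (symZero G A) b)
  refine ⟨m, n, ((symBundle hA G).liftDerivation_mul a b).trans ?_⟩
  change ev (symProj hA G) (ev (symZero G A) a) * symDerivation hA G b +
    ev (symProj hA G) (ev (symZero G A) b) * symDerivation hA G a = _
  rw [← hm, ← hn, map_intCast, map_intCast, ← zsmul_eq_mul, ← zsmul_eq_mul]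

theorem symDerivation_one : symDerivation hA G 1 = 0 := by
  have h := (symBundle hA G).liftDerivation_mul 1 1
  rw [map_one, map_one, one_mul, one_mul] at h
  exact left_eq_add.1 h

/-- The derivation kills constants and fixes the generators, and its value on a product is an
integer combination of its values on the factors. By induction every value lies in degree one. -/
theorem symDerivation_range : (symDerivation hA G).range = (symGen (G := G)).range := by
  refine le_antisymm ?_ ?_
  · rintro _ ⟨x, rfl⟩
    induction x using sym_induction with
    | intCast n =>
      rw [← zsmul_one, map_zsmul, symDerivation_one, zsmul_zero]
      exact zero_mem _
    | symGen g => exact ⟨g, (symDerivation_symGen hA G g).symm⟩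
    | mul a b ha hb =>
      obtain ⟨m, n, h⟩ := symDerivation_mul hA G a b
      rw [h]
      exact add_mem (zsmul_mem hb m) (zsmul_mem ha n)
    | add a b ha hb =>
      rw [map_add]
      exact add_mem ha hb
  · rintro _ ⟨g, rfl⟩
    exact ⟨symGen g, symDerivation_symGen hA G g⟩

/-- The abelian group of the differential object of `G` is `G`. -/
noncomputable def symBundleLiftImageIso (G : AddCommGrpCat.{u}) :
    (symBundle hA G).liftImage ≅ G :=
  AddEquiv.toAddCommGrpIso (X := AddCommGrpCat.of (symDerivation hA G).range)
    ((AddEquiv.addSubgroupCongr (symDerivation_range hA G)).trans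
      (AddMonoidHom.ofInjective symGen_injective).symm)

end CRingOp

theorem DifferentialBundle.liftImageFunctor_isEquivalence {A : CommRingCat.{u}ᵒᵖ}
    (hA : IsTerminal A) : (liftImageFunctor A).IsEquivalence where
  faithful := liftImageFunctor_faithful hA
  full := liftImageFunctor_full hA
  essSurj := ⟨fun G => ⟨CRingOp.symBundle hA G.unop,
    ⟨(CRingOp.symBundleLiftImageIso hA G.unop).symm.op⟩⟩⟩

theorem mainTheorem8 {Z : CommRingCat.{u}ᵒᵖ} (hZ : IsTerminal Z) :
    -- differential objects correspond bijectively (up to isomorphism) to abelian groups, via the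
    -- image of the derivation induced by the lift
    Function.Bijective (DifferentialBundle.liftImageClass Z) ∧
    -- conversely, an abelian group `G` corresponds to the symmetric algebra of `G`
    (∀ G : AddCommGrpCat.{u}, ∃ (𝓔 : DiffObj CRingOp.tangent.{u} hZ)
      (φ : SymmetricAlgebra ℤ G ≃+* 𝓔.E.unop),
      DifferentialBundle.liftImageClass Z (Quotient.mk _ 𝓔) = Quotient.mk _ G ∧
      ∀ g : G,
        CRingOp.ev 𝓔.bundle.zero (φ (SymmetricAlgebra.ι ℤ G g)) = 0 ∧
        CRingOp.ev 𝓔.bundle.add (φ (SymmetricAlgebra.ι ℤ G g)) =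
          CRingOp.ev (fibrePow.π 𝓔.q 0) (φ (SymmetricAlgebra.ι ℤ G g)) +
            CRingOp.ev (fibrePow.π 𝓔.q 1) (φ (SymmetricAlgebra.ι ℤ G g)) ∧
        CRingOp.ev 𝓔.lift (CRingOp.gen (φ (SymmetricAlgebra.ι ℤ G g))) = 0 ∧
        CRingOp.ev 𝓔.lift (CRingOp.dgen (φ (SymmetricAlgebra.ι ℤ G g))) =
          φ (SymmetricAlgebra.ι ℤ G g)) ∧
    -- the category of differential objects is equivalent to the opposite of the category of
    -- `ℤ`-modules, and to the opposite of the category of abelian groups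
    Nonempty (DiffObj CRingOp.tangent.{u} hZ ≌ (ModuleCat.{u} ℤ)ᵒᵖ) ∧
    Nonempty ((ModuleCat.{u} ℤ)ᵒᵖ ≌ AddCommGrpCat.{u}ᵒᵖ) ∧
    (DifferentialBundle.liftImageFunctor Z :
      DiffObj CRingOp.tangent.{u} hZ ⥤ AddCommGrpCat.{u}ᵒᵖ).IsEquivalence := by
  have hF := DifferentialBundle.liftImageFunctor_isEquivalence hZ
  have hclass (G : AddCommGrpCat.{u}) : DifferentialBundle.liftImageClass Z
      (Quotient.mk _ (CRingOp.symBundle hZ G)) = Quotient.mk _ G :=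
    Quotient.sound ⟨CRingOp.symBundleLiftImageIso hZ G⟩
  -- An abelian group carries a unique `ℤ`-module structure, so forgetting it is an equivalence.
  let e : (ModuleCat.{u} ℤ)ᵒᵖ ≌ AddCommGrpCat.{u}ᵒᵖ :=
    (forget₂ (ModuleCat.{u} ℤ) AddCommGrpCat.{u}).asEquivalence.op
  refine ⟨⟨?_, ?_⟩, fun G => ⟨CRingOp.symBundle hZ G, RingEquiv.refl _, hclass G, fun g =>
      ⟨CRingOp.ev_symZero g, CRingOp.ev_symAdd hZ g, CRingOp.ev_symVert_gen g,
        CRingOp.ev_symVert_dgen g⟩⟩,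
    ⟨(DifferentialBundle.liftImageFunctor Z).asEquivalence.trans e.symm⟩, ⟨e⟩, hF⟩
  · rintro ⟨𝓔⟩ ⟨𝓔'⟩ h
    obtain ⟨i⟩ := Quotient.exact h
    -- Full faithfulness lifts the isomorphism of images. The functor lands in the opposite
    -- category, hence the inverse.
    exact Quotient.sound ⟨(DifferentialBundle.liftImageFunctor Z).preimageIso i.symm.op⟩
  · rintro ⟨G⟩
    exact ⟨_, hclass G⟩
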